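/- Let $m,n\ge 0$ and order $\mathbf B=\mathbf B_+\sqcup\mathbf B_-$, $\mathbf B_+=\{\overline m<\dots<\overline 1\}$, $\mathbf B_-=\{1<\dots<n\}$, with every element of $\mathbf B_+$ below every element of $\mathbf B_-$. Let $P=\bigoplus_{b\in\mathbf B}\mathbb Z\epsilon_b$, and let $Q_+\subset P$ be the monoid generated by the positive roots $\epsilon_a-\epsilon_b$ ($a<b$). Regard $\mathbf B$ as the crystal of the vector representation of $U_q(\mathfrak{gl}(m,n))$: $b$ has weight $\epsilon_b$, and there is one arrow from each letter to the next, labelled $$\overline m\xrightarrow{\overline{m-1}}\cdots\xrightarrow{\overline 1}\overline 1\xrightarrow{0}1\xrightarrow{1}\cdots\xrightarrow{n-1}n ,$$ $\tilde f_i$ moving along the $i$-arrow and $\tilde e_i$ against it (the value is $0$ if there is no such arrow). Put $\varepsilon_i(b)=\max\{k:\tilde e_i^kb\ne0\}$ and $\varphi_i(b)=\max\{k:\tilde f_i^kb\ne0\}$. The tensor powers $\mathbf B^{\otimes N}$ carry the crystal structure given by the tensor product rule (signs are ignored, weights add up, and $\mathbf B^{\otimes 0}$ is one element of weight $0$ killed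 by all operators): * for $i=\overline{m-1},\dots,\overline1$: $\tilde e_i(b_1\otimes b_2)$ is $\tilde e_ib_1\otimes b_2$ if $\varphi_i(b_1)\ge\varepsilon_i(b_2)$, otherwise $b_1\otimes\tilde e_ib_2$; and $\tilde f_i(b_1\otimes b_2)$ is $\tilde f_ib_1\otimes b_2$ if $\varphi_i(b_1)>\varepsilon_i(b_2)$, otherwise $b_1\otimes\tilde f_ib_2$; * for $i=1,\dots,n-1$: the same rule with the roles of the two factors exchanged; * for $i=0$: the operators act on $b_1$ if $\langle h_0,\mathrm{wt}(b_1)\rangle>0$, otherwise on $b_2$, where $\langle h_0,\lambda\rangle$ is the sum of the coefficients of $\epsilon_{\overline1}$ and $\epsilon_1$ in $\lambda$. Let $Y$ be an $(m,n)$-hook Young diagram (its $(m+1)$-st row has at most $n$ boxes), with $N$ boxes, and let $B(Y)$ be the set of semistandard tableaux of shape $Y$: fillings with entries in $\mathbf B$ that increase weakly along rows and down columns, with no repetition of elements of $\mathbf B_-$ in a row and no repetition of elements of $\mathbf B_+$ in a column. Choose any admissible reading, that is, any listing of the boxes in which a box is read before every other box lying weakly below and weakly to the left of it; it embeds $B(Y)$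 into $\mathbf B^{\otimes N}$, and $B(Y)$ receives the induced crystal structure, with $\mathrm{wt}(T)$ the sum of the $\epsilon_b$ over the entries $b$ of $T$. Let $H_Y\in B(Y)$ be the tableau whose first $m$ rows are filled with $\overline m,\overline{m-1},\dots,\overline1$ respectively and in whose other rows each box of the $j$-th column contains $j$. An element $b$ of a crystal is a *highest* (*lowest*) *weight vector* if $\tilde e_ib=0$ ($\tilde f_ib=0$) for all $i$. It is a *genuine highest weight vector* if it is the only element of its weight $\lambda$ and all weights of the crystal lie in $\lambda-Q_+$; a *genuine lowest weight vector* if it is the only element of its weight $\mu$ and all weights lie in $\mu+Q_+$. A highest (lowest) weight vector that is not genuine is called *fake*. **Theorem.** For all $m,n\ge0$, every $(m,n)$-hook Young diagram $Y$ and every admissible reading, the crystal graph of $B(Y)$ is connected; moreover $H_Y$ is a genuine highest weight vector, and every $T\in B(Y)$ is joined to $H_Y$ in the crystal graph. This holds although $B(Y)$ can have fake highest and fake lowest weight vectors: for $m=n=2$ and $Y=(3,2,1)$ (with any admissible reading) there is at least one of each. -/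

import Mathlib

namespace SuperCrystal

/-! Conventions.  The ordered set `𝐁 = {m̄ < ⋯ < 1̄ < 1 < ⋯ < n}` is `Fin (m + n)`:
position `a < m` stands for the barred letter of index `m - a` (an element of `𝐁₊`), and
position `m + c` stands for the letter `c + 1` (an element of `𝐁₋`).  Rows and columns of Young
diagrams are numbered from `0`. -/

/-- The index set `I` of the simple roots: `k` stands for the simple root `ε_k - ε_{k+1}`.
It is even positive for `k + 1 < m`, odd for `k + 1 = m`, and even negative for `m ≤ k`. -/
abbrev Idx (m n : ℕ) : Type := {k : ℕ // k + 1 < m + n}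

/-- The letter in position `k`. -/
def Idx.src {m n : ℕ} (i : Idx m n) : Fin (m + n) := ⟨i.1, Nat.lt_of_succ_lt i.2⟩

/-- The letter in position `k + 1`. -/
def Idx.tgt {m n : ℕ} (i : Idx m n) : Fin (m + n) := ⟨i.1 + 1, i.2⟩

/-- The lattice `P` of integral weights, with basis `ε_b` for `b ∈ 𝐁`. -/
abbrev Weight (m n : ℕ) : Type := Fin (m + n) → ℤ

/-- The basis vector `ε_b`. -/
def eps {m n : ℕ} (b : Fin (m + n)) : Weight m n := Pi.single b 1

/-- The symmetric form on `P`: `(ε_b, ε_b) = 1` for `b ∈ 𝐁₊`, `-1` for `b ∈ 𝐁₋`,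
and distinct basis vectors are orthogonal. -/
def form {m n : ℕ} (x y : Weight m n) : ℤ :=
  ∑ b : Fin (m + n), (if b.1 < m then 1 else -1) * x b * y b

/-- The simple root `α_i`. -/
def simpleRoot {m n : ℕ} (i : Idx m n) : Weight m n := eps i.src - eps i.tgt

/-- The sign `ℓ_i`. -/
def ell {m n : ℕ} (i : Idx m n) : ℤ := if i.1 < m then 1 else -1

/-- The pairing `⟨h_i, x⟩`, determined by `ℓ_i ⟨h_i, x⟩ = (α_i, x)`; recall `ℓ_i = ± 1`. -/
def pairing {m n : ℕ} (i : Idx m n) (x : Weight m n) : ℤ := ell i * form (simpleRoot i) x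

/-- The monoid `Q₊` generated by the positive roots `ε_a - ε_b`, `a < b`. -/
def Qplus (m n : ℕ) : AddSubmonoid (Weight m n) :=
  AddSubmonoid.closure {x | ∃ a b : Fin (m + n), a < b ∧ x = eps a - eps b}

/-- The data of a crystal (signs divided out): weights and operators `ẽ_i`, `f̃_i`, with `none`
in the role of `0`. -/
structure Crystal (m n : ℕ) where
  carrier : Type
  wt : carrier → Weight m n
  e : Idx m n → carrier → Option carrier
  f : Idx m n → carrier → Option carrier

namespace Crystal

variable {m n : ℕ}

/-- `ε_i(b) = max {k | ẽ_i^k b ≠ 0}`. -/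
noncomputable def epsilon (C : Crystal m n) (i : Idx m n) (b : C.carrier) : ℕ :=
  sSup {k : ℕ | (fun x : Option C.carrier => x.bind (C.e i))^[k] (some b) ≠ none}

/-- `φ_i(b) = max {k | f̃_i^k b ≠ 0}`. -/
noncomputable def phi (C : Crystal m n) (i : Idx m n) (b : C.carrier) : ℕ :=
  sSup {k : ℕ | (fun x : Option C.carrier => x.bind (C.f i))^[k] (some b) ≠ none}

/-- The crystal `𝐁` of the vector representation, with arrows from each letter to the next one. -/
def vec (m n : ℕ) : Crystal m n where
  carrier := Fin (m + n)
  wt b := eps b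
  e i b := if b = i.tgt then some i.src else none
  f i b := if b = i.src then some i.tgt else none

/-- The crystal of the trivial representation. -/
def triv (m n : ℕ) : Crystal m n where
  carrier := Unit
  wt _ := 0
  e _ _ := none
  f _ _ := none

/-- The tensor product of crystals, by the tensor product rule in each of the three cases. -/
noncomputable def tensor (C D : Crystal m n) : Crystal m n where
  carrier := C.carrier × D.carrier
  wt b := C.wt b.1 + D.wt b.2
  e i b :=
    if i.1 + 1 < m then
      -- `i` even, `ℓ_i > 0`
      if D.epsilon i b.2 ≤ C.phi i b.1 then (C.e i b.1).map (fun x => (x, b.2))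
      else (D.e i b.2).map (fun y => (b.1, y))
    else if i.1 + 1 = m then
      -- `i` odd, `ℓ_i > 0`
      if 0 < pairing i (C.wt b.1) then (C.e i b.1).map (fun x => (x, b.2))
      else (D.e i b.2).map (fun y => (b.1, y))
    else
      -- `i` even, `ℓ_i < 0`
      if C.epsilon i b.1 ≤ D.phi i b.2 then (D.e i b.2).map (fun y => (b.1, y))
      else (C.e i b.1).map (fun x => (x, b.2))
  f i b :=
    if i.1 + 1 < m then
      if D.epsilon i b.2 < C.phi i b.1 then (C.f i b.1).map (fun x => (x, b.2))
      else (D.f i b.2).map (fun y => (b.1, y))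
    else if i.1 + 1 = m then
      if 0 < pairing i (C.wt b.1) then (C.f i b.1).map (fun x => (x, b.2))
      else (D.f i b.2).map (fun y => (b.1, y))
    else
      if C.epsilon i b.1 < D.phi i b.2 then (D.f i b.2).map (fun y => (b.1, y))
      else (C.f i b.1).map (fun x => (x, b.2))

/-- The tensor power `𝐁^{⊗ N} = 𝐁 ⊗ (𝐁 ⊗ ⋯)`. -/
noncomputable def tensorPow (m n : ℕ) : ℕ → Crystal m n
  | 0 => triv m n
  | N + 1 => tensor (vec m n) (tensorPow m n N)

/-- The element `b_1 ⊗ ⋯ ⊗ b_N` of `𝐁^{⊗ N}`. -/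
def pure : (N : ℕ) → (Fin N → Fin (m + n)) → (tensorPow m n N).carrier
  | 0, _ => ()
  | N + 1, b => (b 0, pure N (fun k => b k.succ))

/-- The crystal graph, colours and orientations forgotten. -/
def graph (C : Crystal m n) : SimpleGraph C.carrier :=
  SimpleGraph.fromRel (fun b b' => ∃ i, C.f i b = some b')

/-- Highest weight vectors. -/
def IsHighest (C : Crystal m n) (b : C.carrier) : Prop := ∀ i, C.e i b = none

/-- Lowest weight vectors. -/
def IsLowest (C : Crystal m n) (b : C.carrier) : Prop := ∀ i, C.f i b = none

/-- Genuine highest weight vectors: `b` is the only element of its weight `λ`, and all weights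
lie in `λ - Q₊`. -/
def IsGenuineHighest (C : Crystal m n) (b : C.carrier) : Prop :=
  (∀ b', C.wt b' = C.wt b → b' = b) ∧ ∀ b', C.wt b - C.wt b' ∈ Qplus m n

/-- Genuine lowest weight vectors: `b` is the only element of its weight `μ`, and all weights
lie in `μ + Q₊`. -/
def IsGenuineLowest (C : Crystal m n) (b : C.carrier) : Prop :=
  (∀ b', C.wt b' = C.wt b → b' = b) ∧ ∀ b', C.wt b' - C.wt b ∈ Qplus m n

/-- Fake highest weight vectors. -/
def IsFakeHighest (C : Crystal m n) (b : C.carrier) : Prop :=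
  C.IsHighest b ∧ ¬ C.IsGenuineHighest b

/-- Fake lowest weight vectors. -/
def IsFakeLowest (C : Crystal m n) (b : C.carrier) : Prop :=
  C.IsLowest b ∧ ¬ C.IsGenuineLowest b

end Crystal

/-- `(m, n)`-hook Young diagrams: the `(m+1)`-st row has at most `n` boxes. -/
def IsHook (m n : ℕ) (Y : YoungDiagram) : Prop := Y.rowLen m ≤ n

/-- Semistandard tableaux of shape `Y` with entries in `𝐁`: rows and columns increase weakly,
entries in `𝐁₋` are not repeated in a row, entries in `𝐁₊` are not repeated in a column. -/
@[ext]
structure Tableau (m n : ℕ) (Y : YoungDiagram) where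
  entry : {c : ℕ × ℕ // c ∈ Y.cells} → Fin (m + n)
  row_le : ∀ c d : {c : ℕ × ℕ // c ∈ Y.cells}, c.1.1 = d.1.1 → c.1.2 < d.1.2 → entry c ≤ entry d
  row_ne : ∀ c d : {c : ℕ × ℕ // c ∈ Y.cells}, c.1.1 = d.1.1 → c.1.2 < d.1.2 →
    entry c = entry d → (entry c).1 < m
  col_le : ∀ c d : {c : ℕ × ℕ // c ∈ Y.cells}, c.1.2 = d.1.2 → c.1.1 < d.1.1 → entry c ≤ entry d
  col_ne : ∀ c d : {c : ℕ × ℕ // c ∈ Y.cells}, c.1.2 = d.1.2 → c.1.1 < d.1.1 →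
    entry c = entry d → m ≤ (entry c).1

/-- Readings: listings of the boxes of `Y`. -/
abbrev Reading (Y : YoungDiagram) : Type := Fin Y.card ≃ {c : ℕ × ℕ // c ∈ Y.cells}

/-- `c` is strictly higher than `d`: it is another box, weakly above and weakly to the right. -/
def StrictlyHigher (c d : ℕ × ℕ) : Prop := c ≠ d ∧ c.1 ≤ d.1 ∧ d.2 ≤ c.2

/-- A reading is admissible if strictly higher boxes are read first. -/
def Admissible {Y : YoungDiagram} (r : Reading Y) : Prop :=
  ∀ c d : {c : ℕ × ℕ // c ∈ Y.cells}, StrictlyHigher c.1 d.1 → r.symm c < r.symm d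

/-- The embedding of the set of tableaux into `𝐁^{⊗ N}` given by a reading. -/
def read {m n : ℕ} {Y : YoungDiagram} (r : Reading Y) (T : Tableau m n Y) :
    (Crystal.tensorPow m n Y.card).carrier :=
  Crystal.pure Y.card (fun k => T.entry (r k))

/-- The crystal `B(Y)`: the structure of `𝐁^{⊗ N}` carried back along a reading. -/
noncomputable def crystalOf (m n : ℕ) (Y : YoungDiagram) (r : Reading Y) : Crystal m n where
  carrier := Tableau m n Y
  wt T := ∑ c, eps (T.entry c)
  e i T := ((Crystal.tensorPow m n Y.card).e i (read r T)).bind (Function.partialInv (read r))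
  f i T := ((Crystal.tensorPow m n Y.card).f i (read r T)).bind (Function.partialInv (read r))

/-- The tableau `H_Y`: the first `m` rows are filled with `m̄, …, 1̄`, row by row, and in the
remaining rows every box of the `j`-th column is filled with the letter `j`. -/
def highestTableau {m n : ℕ} {Y : YoungDiagram} (hY : IsHook m n Y) : Tableau m n Y where
  entry c := if h : c.1.1 < m then ⟨c.1.1, Nat.lt_add_right n h⟩ else
    ⟨m + c.1.2, Nat.add_lt_add_left ((YoungDiagram.mem_iff_lt_rowLen.1 ((YoungDiagram.mem_cells _).1 c.2)).trans_le
      ((Y.rowLen_anti m c.1.1 (not_lt.1 h)).trans hY)) m⟩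
  row_le := by
    intro c d h1 h2
    split_ifs <;> simp only [Fin.mk_le_mk] <;> omega
  row_ne := by
    intro c d h1 h2
    split_ifs <;> simp only [Fin.mk.injEq] <;> omega
  col_le := by
    intro c d h1 h2
    split_ifs <;> simp only [Fin.mk_le_mk] <;> omega
  col_ne := by
    intro c d h1 h2
    split_ifs <;> simp only [Fin.mk.injEq] <;> omega

/-- The Young diagram with rows of `3`, `2` and `1` boxes. -/
def staircase : YoungDiagram := YoungDiagram.ofRowLens [3, 2, 1] (by decide)

end SuperCrystal

/-! Connectedness is proved by induction on the number `L` of admitted letters, for all shapes at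
once (`allLinked`). The boxes with letters below `L` form a smaller diagram. An operator that only
involves letters below `L` ignores the boxes filled with `L`, so by induction the smaller part may
be rearranged at will inside the larger tableau (`Step.extend`, `linked_of_below`). It therefore
suffices to move the largest letter `L` to a set of boxes that depends on the shape alone; two
tableaux with `L` in the same boxes are then linked by the induction hypothesis
(`allLinked_of_canonical`).

If `L ≤ m`, the canonical boxes are those in rows `≥ L`, where `L` is forced. As long as some `L`
stands higher, the smaller part is made a highest weight tableau, and one suitable `L` becomes `L -
1` under a raising operator (`exists_linked_fewer`). If `L > m`, the canonical boxes are the row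
ends. As long as some row does not end in `L`, the smaller part is arranged with `L - 1` at the end
of each of its rows, and one such letter becomes `L` under a lowering operator
(`exists_linked_more`). Both moves rest on the signature rule (`f_pure_of_pos`, `f_pure_of_odd`,
`f_pure_of_neg`) and on explicit matchings of neighbouring boxes, which are valid for every
admissible reading.

`H_Y` is genuine because it is entrywise minimal (`SST.highestFilling_le`). The fake vectors are two
explicit tableaux; the linear functional `height`, nonpositive on `Qplus`, shows that they are not
genuine. -/

namespace SuperCrystal

/-! ### How often a partial map can be applied. -/

/-- `HasDepth g b k`: the partial map `g` can be applied to `b` exactly `k` times. -/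
inductive HasDepth {X : Type} (g : X → Option X) : X → ℕ → Prop
  | zero {b : X} : g b = none → HasDepth g b 0
  | succ {b b' : X} {k : ℕ} : g b = some b' → HasDepth g b' k → HasDepth g b (k + 1)

theorem HasDepth.iterate_ne_none_iff {X : Type} {g : X → Option X} {b : X} {k : ℕ}
    (h : HasDepth g b k) (j : ℕ) :
    (fun x : Option X => x.bind g)^[j] (some b) ≠ none ↔ j ≤ k := by
  have hnone : ∀ j : ℕ, (fun x : Option X => x.bind g)^[j] none = none := by
    intro j
    induction j with
    | zero => rfl
    | succ j ih => rw [Function.iterate_succ_apply]; exact ih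
  induction h generalizing j with
  | zero h =>
    cases j with
    | zero => simp
    | succ j => rw [Function.iterate_succ_apply]; simp [h, hnone]
  | succ h _ ih =>
    cases j with
    | zero => simp
    | succ j => rw [Function.iterate_succ_apply]; simp only [Option.bind_some, h, ih]; omega

theorem HasDepth.sSup_eq {X : Type} {g : X → Option X} {b : X} {k : ℕ} (h : HasDepth g b k) :
    sSup {j : ℕ | (fun x : Option X => x.bind g)^[j] (some b) ≠ none} = k := by
  simp only [h.iterate_ne_none_iff]
  exact csSup_Iic

theorem HasDepth.unique {X : Type} {g : X → Option X} {b : X} {k l : ℕ}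
    (h : HasDepth g b k) (h' : HasDepth g b l) : k = l :=
  h.sSup_eq.symm.trans h'.sSup_eq

theorem HasDepth.eq_none {X : Type} {g : X → Option X} {b : X} (h : HasDepth g b 0) :
    g b = none := by
  cases h
  assumption

theorem HasDepth.exists_some {X : Type} {g : X → Option X} {b : X} {k : ℕ}
    (h : HasDepth g b (k + 1)) : ∃ b', g b = some b' ∧ HasDepth g b' k := by
  cases h with
  | succ h h' => exact ⟨_, h, h'⟩

/-- The contribution `1`, `-1`, `0` of a letter to the signature in which `a` counts positively
and `a'` negatively. -/
def sgn {A : Type} [DecidableEq A] (a a' x : A) : ℤ :=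
  if x = a then 1 else if x = a' then -1 else 0

/-- The tail is used until the test fails. Then a head `a` allows one more application, while a head
`a'` has blocked the last application to the tail. This is the recursion of the largest partial sum
of a signature. -/
theorem HasDepth.prod {A X : Type} [DecidableEq A] {a a' : A} (hne : a ≠ a')
    {g : X → Option X} {d : X → ℕ} {G : A × X → Option (A × X)}
    (hG : ∀ x y, G (x, y) = if (if x = a' then 1 else 0) < d y
      then (g y).map (fun y' => (x, y'))
      else (if x = a then some a' else none).map (fun x' => (x', y)))
    (hd : ∀ y, HasDepth g y (d y)) (x : A) (y : X) :
    HasDepth G (x, y) (sgn a a' x + d y).toNat := by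
  have key : ∀ (k : ℕ) (y : X), d y = k → HasDepth G (x, y) (sgn a a' x + k).toNat := by
    intro k
    induction k with
    | zero =>
      intro y hy
      by_cases hx : x = a
      · subst hx
        have h1 : G (x, y) = some (a', y) := by simp [hG, hy]
        have h2 : G (a', y) = none := by simp [hG, hy, hne.symm]
        simpa [sgn] using HasDepth.succ h1 (HasDepth.zero h2)
      · have h1 : G (x, y) = none := by simp [hG, hy, hx]
        have h2 : (sgn a a' x + ((0 : ℕ) : ℤ)).toNat = 0 := by
          simp only [sgn, hx, if_false]; split_ifs <;> rfl
        rw [h2]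
        exact HasDepth.zero h1
    | succ k ih =>
      intro y hy
      obtain ⟨y', h1, h2⟩ := (hy ▸ hd y : HasDepth g y (k + 1)).exists_some
      have h3 := ih y' ((hd y').unique h2)
      by_cases hx : (if x = a' then 1 else 0) < k + 1
      · have h4 : G (x, y) = some (x, y') := by rw [hG, hy, if_pos hx, h1]; rfl
        have h5 : (sgn a a' x + ((k + 1 : ℕ) : ℤ)).toNat = (sgn a a' x + (k : ℤ)).toNat + 1 := by
          simp only [sgn]
          split_ifs at hx ⊢ <;> omega
        rw [h5]
        exact HasDepth.succ h4 h3
      · have hx' : x = a' := by by_contra h; simp [h] at hx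
        have hk : k = 0 := by simp [hx'] at hx; exact hx
        have h4 : G (x, y) = none := by
          rw [hG, hy, if_neg hx, hx', if_neg hne.symm]; rfl
        have h5 : (sgn a a' x + ((k + 1 : ℕ) : ℤ)).toNat = 0 := by
          simp [sgn, hx', hk, hne.symm]
        rw [h5]
        exact HasDepth.zero h4
  exact key _ y rfl

/-! ### The signature rule in tensor powers of the vector representation. -/

namespace Crystal

variable {m n : ℕ}

theorem src_ne_tgt (i : Idx m n) : i.src ≠ i.tgt := by
  simp [Idx.src, Idx.tgt]

theorem vec_epsilon (i : Idx m n) (x : Fin (m + n)) :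
    (vec m n).epsilon i x = if x = i.tgt then 1 else 0 := by
  by_cases h : x = i.tgt
  · have h1 : (vec m n).e i x = some i.src := if_pos h
    have h2 : (vec m n).e i i.src = none := if_neg (src_ne_tgt i)
    rw [if_pos h]
    exact (HasDepth.succ h1 (HasDepth.zero h2)).sSup_eq
  · have h1 : (vec m n).e i x = none := if_neg h
    rw [if_neg h]
    exact (HasDepth.zero h1).sSup_eq

theorem vec_phi (i : Idx m n) (x : Fin (m + n)) :
    (vec m n).phi i x = if x = i.src then 1 else 0 := by
  by_cases h : x = i.src
  · have h1 : (vec m n).f i x = some i.tgt := if_pos h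
    have h2 : (vec m n).f i i.tgt = none := if_neg (src_ne_tgt i).symm
    rw [if_pos h]
    exact (HasDepth.succ h1 (HasDepth.zero h2)).sSup_eq
  · have h1 : (vec m n).f i x = none := if_neg h
    rw [if_neg h]
    exact (HasDepth.zero h1).sSup_eq

/-- The largest initial partial sum of the signature of an element of `𝐁^{⊗ N}`. -/
def maxPartialSum (a a' : Fin (m + n)) : (N : ℕ) → (tensorPow m n N).carrier → ℕ
  | 0, _ => 0
  | N + 1, b => (sgn a a' b.1 + maxPartialSum a a' N b.2).toNat

/-- With tensor powers nested to the right, the rule for these colours compares `φ_i` of a single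
letter with `ε_i` of the tail. So the recursion closes on the depth of `ẽ_i`; for the colours above
the odd one it closes on that of `f̃_i`. -/
theorem hasDepth_e (i : Idx m n) (hi : i.1 + 1 < m) :
    ∀ (N : ℕ) (b : (tensorPow m n N).carrier),
      HasDepth ((tensorPow m n N).e i) b (maxPartialSum i.tgt i.src N b)
  | 0, _ => HasDepth.zero rfl
  | N + 1, b => by
    have ih := hasDepth_e i hi N
    refine HasDepth.prod (src_ne_tgt i).symm (d := maxPartialSum i.tgt i.src N) ?_ ih b.1 b.2
    intro x y
    have h : (tensorPow m n N).epsilon i y = maxPartialSum i.tgt i.src N y := (ih y).sSup_eq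
    change (tensor (vec m n) (tensorPow m n N)).e i (x, y) = _
    simp only [tensor, hi, if_true, vec_phi, h]
    by_cases hlt : (if x = i.src then 1 else 0) < maxPartialSum i.tgt i.src N y
    · rw [if_pos hlt, if_neg hlt.not_ge]
      rfl
    · rw [if_neg hlt, if_pos (not_lt.1 hlt)]
      rfl

theorem hasDepth_f (i : Idx m n) (hi : m < i.1 + 1) :
    ∀ (N : ℕ) (b : (tensorPow m n N).carrier),
      HasDepth ((tensorPow m n N).f i) b (maxPartialSum i.src i.tgt N b)
  | 0, _ => HasDepth.zero rfl
  | N + 1, b => by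
    have ih := hasDepth_f i hi N
    refine HasDepth.prod (src_ne_tgt i) (d := maxPartialSum i.src i.tgt N) ?_ ih b.1 b.2
    intro x y
    have h : (tensorPow m n N).phi i y = maxPartialSum i.src i.tgt N y := (ih y).sSup_eq
    change (tensor (vec m n) (tensorPow m n N)).f i (x, y) = _
    simp only [tensor, hi.not_gt, hi.ne', if_false, vec_epsilon, h]
    rfl

theorem le_maxPartialSum (a a' : Fin (m + n)) : ∀ (N : ℕ) (b : Fin N → Fin (m + n)) (t : ℕ),
    ∑ j : Fin N, (if j.1 < t then sgn a a' (b j) else 0) ≤ maxPartialSum a a' N (pure N b)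
  | 0, _, _ => by simp [maxPartialSum]
  | N + 1, b, 0 => by simp
  | N + 1, b, t + 1 => by
    have ih := le_maxPartialSum a a' N (fun k => b k.succ) t
    rw [Fin.sum_univ_succ]
    simp only [Fin.val_zero, Nat.succ_pos, if_true, Fin.val_succ, Nat.add_lt_add_iff_right]
    change _ ≤ (((sgn a a' (b 0) + maxPartialSum a a' N (pure N fun k => b k.succ)).toNat : ℕ) : ℤ)
    have := Int.self_le_toNat (sgn a a' (b 0) + maxPartialSum a a' N (pure N fun k => b k.succ))
    linarith

theorem exists_maxPartialSum_eq (a a' : Fin (m + n)) : ∀ (N : ℕ) (b : Fin N → Fin (m + n)),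
    ∃ t : ℕ, (maxPartialSum a a' N (pure N b) : ℤ) =
      ∑ j : Fin N, (if j.1 < t then sgn a a' (b j) else 0)
  | 0, _ => ⟨0, by simp [maxPartialSum]⟩
  | N + 1, b => by
    obtain ⟨t, ht⟩ := exists_maxPartialSum_eq a a' N (fun k => b k.succ)
    by_cases h : 0 ≤ sgn a a' (b 0) + maxPartialSum a a' N (pure N fun k => b k.succ)
    · refine ⟨t + 1, ?_⟩
      rw [Fin.sum_univ_succ]
      simp only [Fin.val_zero, Nat.succ_pos, if_true, Fin.val_succ, Nat.add_lt_add_iff_right,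
        ← ht]
      exact Int.toNat_of_nonneg h
    · refine ⟨0, ?_⟩
      simp only [Nat.not_lt_zero, if_false, Finset.sum_const_zero]
      exact_mod_cast Int.toNat_of_nonpos (not_le.1 h).le

theorem maxPartialSum_eq_zero {a a' : Fin (m + n)} {N : ℕ} {b : Fin N → Fin (m + n)}
    (h : ∀ t : ℕ, ∑ j : Fin N, (if j.1 < t then sgn a a' (b j) else 0) ≤ 0) :
    maxPartialSum a a' N (pure N b) = 0 := by
  obtain ⟨t, ht⟩ := exists_maxPartialSum_eq a a' N b
  have := h t
  omega

theorem pure_update_zero {N : ℕ} (b : Fin (N + 1) → Fin (m + n)) (x : Fin (m + n)) :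
    pure (N + 1) (Function.update b 0 x) = (x, pure N fun k => b k.succ) := by
  simp only [pure, Function.update_self]
  rfl

theorem pure_update_succ {N : ℕ} (b : Fin (N + 1) → Fin (m + n)) (k : Fin N) (x : Fin (m + n)) :
    pure (N + 1) (Function.update b k.succ x) =
      (b 0, pure N (Function.update (fun k => b k.succ) k x)) := by
  have h1 : Function.update b k.succ x 0 = b 0 :=
    Function.update_of_ne (Fin.succ_ne_zero k).symm _ _
  have h2 : (fun j => Function.update b k.succ x (Fin.succ j)) =
      Function.update (fun k => b k.succ) k x := by
    funext j
    by_cases h : j = k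
    · simp [h]
    · simp [Function.update_of_ne, h]
  simp only [pure, h1, h2]
  rfl

theorem sum_Ico_succ {N : ℕ} (g : Fin (N + 1) → ℤ) (k : Fin N) (t : ℕ) :
    ∑ j, (if t + 1 ≤ j.1 ∧ j < k.succ then g j else 0) =
      ∑ j : Fin N, (if t ≤ j.1 ∧ j < k then g j.succ else 0) := by
  rw [Fin.sum_univ_succ]
  simp

theorem sum_Ioo_succ {N : ℕ} (g : Fin (N + 1) → ℤ) (k : Fin N) (t : ℕ) :
    ∑ j, (if k.succ < j ∧ j.1 < t + 1 then g j else 0) =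
      ∑ j : Fin N, (if k < j ∧ j.1 < t then g j.succ else 0) := by
  rw [Fin.sum_univ_succ]
  simp

theorem sum_Ioo_zero {N : ℕ} (g : Fin (N + 1) → ℤ) (t : ℕ) :
    ∑ j, (if 0 < j ∧ j.1 < t + 1 then g j else 0) =
      ∑ j : Fin N, (if j.1 < t then g j.succ else 0) := by
  rw [Fin.sum_univ_succ]
  simp

theorem sum_Ico_zero_succ {N : ℕ} (g : Fin (N + 1) → ℤ) (k : Fin N) :
    ∑ j, (if 0 ≤ j.1 ∧ j < k.succ then g j else 0) =
      g 0 + ∑ j : Fin N, (if j.1 < k.1 then g j.succ else 0) := by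
  rw [Fin.sum_univ_succ]
  simp

theorem sum_lt_succ {N : ℕ} (g : Fin N → ℤ) (k : Fin N) :
    ∑ j : Fin N, (if j.1 < k.1 + 1 then g j else 0) =
      g k + ∑ j : Fin N, (if j.1 < k.1 then g j else 0) := by
  have h : ∀ j : Fin N, (if j.1 < k.1 + 1 then g j else 0) =
      (if j = k then g j else 0) + (if j.1 < k.1 then g j else 0) := by
    intro j
    rcases lt_trichotomy j k with h | h | h
    · have := Fin.lt_def.1 h
      rw [if_pos (by omega), if_neg h.ne, if_pos this, zero_add]
    · subst h
      simp
    · have := Fin.lt_def.1 h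
      rw [if_neg (by omega), if_neg h.ne', if_neg (by omega), zero_add]
  rw [Finset.sum_congr rfl fun j _ => h j, Finset.sum_add_distrib]
  simp

/-- Count `i.src` as `+` and `i.tgt` as `-`. The hypotheses say that each `-` before `k` cancels
with a later `+` before `k`, and each `+` after `k` with an earlier `-` after `k`. The `+` at `k`
thus survives, and the tensor rule passes to the tail until position `k` is the head. -/
theorem f_pure_of_neg {i : Idx m n} (hi : m < i.1 + 1) :
    ∀ {N : ℕ} (b : Fin N → Fin (m + n)) (k : Fin N), b k = i.src →
      (∀ t : ℕ, 0 ≤ ∑ j : Fin N, (if t ≤ j.1 ∧ j < k then sgn i.src i.tgt (b j) else 0)) →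
      (∀ t : ℕ, ∑ j : Fin N, (if k < j ∧ j.1 < t then sgn i.src i.tgt (b j) else 0) ≤ 0) →
      (tensorPow m n N).f i (pure N b) = some (pure N (Function.update b k i.tgt))
  | 0, _, k, _, _, _ => k.elim0
  | N + 1, b, k, hk, h1, h2 => by
    have hphi : ∀ y, (tensorPow m n N).phi i y = maxPartialSum i.src i.tgt N y :=
      fun y => (hasDepth_f i hi N y).sSup_eq
    change (tensor (vec m n) (tensorPow m n N)).f i (b 0, pure N fun k => b k.succ) = _
    simp only [tensor, hi.not_gt, hi.ne', if_false, vec_epsilon, hphi]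
    refine Fin.cases ?_ (fun k => ?_) k hk h1 h2
    · intro hk _ h2
      have h0 : maxPartialSum i.src i.tgt N (pure N fun k => b k.succ) = 0 :=
        maxPartialSum_eq_zero fun t => by have := h2 (t + 1); rwa [sum_Ioo_zero] at this
      rw [pure_update_zero, h0, if_neg (Nat.not_lt_zero _), hk]
      simp only [vec, if_true]
      rfl
    · intro hk h1 h2
      have ih := f_pure_of_neg hi (fun k => b k.succ) k hk
        (fun t => by have := h1 (t + 1); rwa [sum_Ico_succ] at this)
        (fun t => by have := h2 (t + 1); rwa [sum_Ioo_succ] at this)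
      have h3 := h1 0
      have h4 := le_maxPartialSum i.src i.tgt N (fun k => b k.succ) (k.1 + 1)
      rw [sum_lt_succ, hk] at h4
      rw [sum_Ico_zero_succ] at h3
      -- The letter in position `k` adds `1` to the sum before `k`. That sum is already at least `1`
      -- if the head is `i.tgt`, and at least `0` in any case.
      have h7 : (if b 0 = i.tgt then 1 else 0) <
          maxPartialSum i.src i.tgt N (pure N fun k => b k.succ) := by
        have hs := src_ne_tgt i
        have h8 : sgn i.src i.tgt i.src = 1 := by simp [sgn]
        by_cases hb : b 0 = i.tgt
        · have h9 : sgn i.src i.tgt (b 0) = -1 := by simp [sgn, hb, hs.symm]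
          rw [if_pos hb]
          omega
        · have h9 : sgn i.src i.tgt (b 0) = 0 ∨ b 0 = i.src := by
            by_cases hb' : b 0 = i.src
            · exact Or.inr hb'
            · exact Or.inl (by simp [sgn, hb, hb'])
          rw [if_neg hb]
          rcases Nat.eq_zero_or_pos (maxPartialSum i.src i.tgt N (pure N fun k => b k.succ))
            with h0 | h0
          · have h10 := h1 1
            rw [sum_Ico_succ] at h10
            simp only [zero_le, true_and, Fin.lt_def] at h10
            omega
          · exact h0
      rw [if_pos h7, ih, pure_update_succ]
      rfl

/-- The two factors play exchanged roles, so the signs are reversed: `i.tgt` counts as `+`, and `k`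
carries an uncancelled `-`. -/
theorem f_pure_of_pos {i : Idx m n} (hi : i.1 + 1 < m) :
    ∀ {N : ℕ} (b : Fin N → Fin (m + n)) (k : Fin N), b k = i.src →
      (∀ t : ℕ, 0 ≤ ∑ j : Fin N, (if t ≤ j.1 ∧ j < k then sgn i.tgt i.src (b j) else 0)) →
      (∀ t : ℕ, ∑ j : Fin N, (if k < j ∧ j.1 < t then sgn i.tgt i.src (b j) else 0) ≤ 0) →
      (tensorPow m n N).f i (pure N b) = some (pure N (Function.update b k i.tgt))
  | 0, _, k, _, _, _ => k.elim0
  | N + 1, b, k, hk, h1, h2 => by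
    have heps : ∀ y, (tensorPow m n N).epsilon i y = maxPartialSum i.tgt i.src N y :=
      fun y => (hasDepth_e i hi N y).sSup_eq
    change (tensor (vec m n) (tensorPow m n N)).f i (b 0, pure N fun k => b k.succ) = _
    simp only [tensor, hi, if_true, vec_phi, heps]
    refine Fin.cases ?_ (fun k => ?_) k hk h1 h2
    · intro hk _ h2
      have h0 : maxPartialSum i.tgt i.src N (pure N fun k => b k.succ) = 0 :=
        maxPartialSum_eq_zero fun t => by have := h2 (t + 1); rwa [sum_Ioo_zero] at this
      rw [pure_update_zero, h0, hk, if_pos rfl, if_pos Nat.one_pos]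
      simp only [vec, if_true]
      rfl
    · intro hk h1 h2
      have ih := f_pure_of_pos hi (fun k => b k.succ) k hk
        (fun t => by have := h1 (t + 1); rwa [sum_Ico_succ] at this)
        (fun t => by have := h2 (t + 1); rwa [sum_Ioo_succ] at this)
      have h3 := h1 0
      have h4 := le_maxPartialSum i.tgt i.src N (fun k => b k.succ) k.1
      rw [sum_Ico_zero_succ] at h3
      have h7 : ¬ maxPartialSum i.tgt i.src N (pure N fun k => b k.succ) <
          (if b 0 = i.src then 1 else 0) := by
        by_cases hb : b 0 = i.src
        · have h9 : sgn i.tgt i.src (b 0) = -1 := by simp [sgn, hb, src_ne_tgt i]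
          rw [if_pos hb]
          omega
        · rw [if_neg hb]
          exact Nat.not_lt_zero _
      rw [if_neg h7, ih, pure_update_succ]
      rfl

/-- The sign of the form on `𝐁₋` cancels the sign of `i.tgt` in the simple root. Hence the odd
operators act on the first letter that is `i.src` or `i.tgt`. -/
theorem pairing_eps_pos_iff {i : Idx m n} (hi : i.1 + 1 = m) (x : Fin (m + n)) :
    0 < pairing i (eps x) ↔ x = i.src ∨ x = i.tgt := by
  have h1 : pairing i (eps x) =
      (if x.1 < m then 1 else -1) * (simpleRoot i x) := by
    simp only [pairing, ell, form, eps]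
    rw [if_pos (by omega), one_mul, Finset.sum_eq_single x]
    · simp
    · intro b _ hb
      simp [hb]
    · simp
  have h2 : simpleRoot i x = (if x = i.src then 1 else 0) - (if x = i.tgt then 1 else 0) := by
    simp [simpleRoot, eps, Pi.single_apply]
  rw [h1, h2]
  have h3 : i.src.1 < m := by simp only [Idx.src]; omega
  have h4 : ¬ i.tgt.1 < m := by simp only [Idx.tgt]; omega
  have h5 := src_ne_tgt i
  by_cases hs : x = i.src
  · simp [hs, h3, h5]
  · by_cases ht : x = i.tgt
    · simp [ht, h4, h5.symm]
    · simp [hs, ht]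

theorem f_pure_of_odd {i : Idx m n} (hi : i.1 + 1 = m) :
    ∀ {N : ℕ} (b : Fin N → Fin (m + n)) (k : Fin N), b k = i.src →
      (∀ j < k, b j ≠ i.src ∧ b j ≠ i.tgt) →
      (tensorPow m n N).f i (pure N b) = some (pure N (Function.update b k i.tgt))
  | 0, _, k, _, _ => k.elim0
  | N + 1, b, k, hk, h1 => by
    change (tensor (vec m n) (tensorPow m n N)).f i (b 0, pure N fun k => b k.succ) = _
    simp only [tensor, hi, lt_irrefl, if_false, if_true]
    have hp : 0 < pairing i ((vec m n).wt (b 0)) ↔ b 0 = i.src ∨ b 0 = i.tgt :=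
      pairing_eps_pos_iff hi (b 0)
    refine Fin.cases ?_ (fun k => ?_) k hk h1
    · intro hk _
      rw [pure_update_zero, if_pos (hp.2 (Or.inl hk)), hk]
      simp only [vec, if_true]
      rfl
    · intro hk h1
      have ih := f_pure_of_odd hi (fun k => b k.succ) k hk
        (fun j hj => h1 j.succ (Fin.succ_lt_succ_iff.2 hj))
      have h0 := h1 0 k.succ_pos
      rw [if_neg (fun h => (hp.1 h).elim h0.1 h0.2), ih, pure_update_succ]
      rfl

end Crystal
end SuperCrystal
-- Fillings of the quadrant, gluing, and linking of tableaux.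
namespace SuperCrystal

/-- Semistandardness on `Y`, with letters below `L`, for a filling of the whole quadrant. -/
structure SST (m L : ℕ) (Y : YoungDiagram) (T : ℕ × ℕ → ℕ) : Prop where
  lt : ∀ c ∈ Y, T c < L
  row : ∀ {i j j' : ℕ}, (i, j') ∈ Y → j < j' →
    T (i, j) ≤ T (i, j') ∧ (T (i, j) = T (i, j') → T (i, j) < m)
  col : ∀ {i i' j : ℕ}, (i', j) ∈ Y → i < i' →
    T (i, j) ≤ T (i', j) ∧ (T (i, j) = T (i', j) → m ≤ T (i, j))

/-- The filling underlying the tableaux `H_Y`. -/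
def highestFilling (m : ℕ) (c : ℕ × ℕ) : ℕ := if c.1 < m then c.1 else m + c.2

namespace SST

variable {m L : ℕ} {Y : YoungDiagram} {T S : ℕ × ℕ → ℕ}

theorem congr (h : SST m L Y T) (hTS : ∀ c ∈ Y, T c = S c) : SST m L Y S where
  lt c hc := hTS c hc ▸ h.lt c hc
  row {i j j'} hc hj := by
    rw [← hTS _ hc, ← hTS _ (Y.up_left_mem le_rfl hj.le hc)]
    exact h.row hc hj
  col {i i' j} hc hi := by
    rw [← hTS _ hc, ← hTS _ (Y.up_left_mem hi.le le_rfl hc)]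
    exact h.col hc hi

theorem mono (h : SST m L Y T) {i i' j j' : ℕ} (hc : (i', j') ∈ Y) (hi : i ≤ i') (hj : j ≤ j') :
    T (i, j) ≤ T (i', j') := by
  have h1 : T (i, j') ≤ T (i', j') := by
    rcases hi.eq_or_lt with rfl | hi
    · exact le_rfl
    · exact (h.col hc hi).1
  rcases hj.eq_or_lt with rfl | hj
  · exact h1
  · exact (h.row (Y.up_left_mem hi le_rfl hc) hj).1.trans h1

/-- Going down a column, letters below `m` increase strictly, so the letter is at least `min i m`.
In rows from `m` on all letters are `≥ m` and increase strictly along the row. -/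
theorem highestFilling_le (h : SST m L Y T) {c : ℕ × ℕ} (hc : c ∈ Y) :
    highestFilling m c ≤ T c := by
  have h1 : ∀ i j, (i, j) ∈ Y → min i m ≤ T (i, j) := by
    intro i j
    induction i with
    | zero => simp
    | succ i ih =>
      intro hc
      have h2 := h.col hc (Nat.lt_succ_self i)
      have h3 := ih (Y.up_left_mem (Nat.le_succ i) le_rfl hc)
      omega
  obtain ⟨i, j⟩ := c
  unfold highestFilling
  split_ifs with hi
  · have := h1 i j hc
    simp only at hi ⊢
    omega
  · simp only [not_lt] at hi
    induction j with
    | zero =>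
      have := h1 i 0 hc
      simp only
      omega
    | succ j ih =>
      have h2 := h.row hc (Nat.lt_succ_self j)
      have h3 := ih (Y.up_left_mem le_rfl (Nat.le_succ j) hc)
      simp only at h3 ⊢
      omega

/-- The diagram of the boxes with letters below `z`. -/
def below (h : SST m L Y T) (z : ℕ) : YoungDiagram where
  cells := Y.cells.filter fun c => T c < z
  isLowerSet := by
    rintro ⟨i', j'⟩ ⟨i, j⟩ ⟨hi, hj⟩ hc
    simp only [Finset.coe_filter, YoungDiagram.mem_cells, Set.mem_ofPred_eq] at hc ⊢
    exact ⟨Y.up_left_mem hi hj hc.1, (h.mono hc.1 hi hj).trans_lt hc.2⟩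

theorem mem_below (h : SST m L Y T) {z : ℕ} {c : ℕ × ℕ} : c ∈ h.below z ↔ c ∈ Y ∧ T c < z := by
  rw [← YoungDiagram.mem_cells]
  simp [below]

theorem restrict_below (h : SST m L Y T) (z : ℕ) : SST m z (h.below z) T where
  lt _ hc := (h.mem_below.1 hc).2
  row hc := h.row (h.mem_below.1 hc).1
  col hc := h.col (h.mem_below.1 hc).1

theorem eq_of_not_mem_below (h : SST m (L + 1) Y T) {c : ℕ × ℕ} (hc : c ∈ Y)
    (hc' : c ∉ h.below L) : T c = L := by
  have h1 := h.lt c hc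
  have h2 : ¬ T c < L := fun h2 => hc' (h.mem_below.2 ⟨hc, h2⟩)
  omega

/-- The boxes outside `h.below L` contain `L`, which exceeds every letter inside, so only
comparisons within one of the two parts matter. -/
theorem glue (h : SST m (L + 1) Y T) (hS : SST m L (h.below L) S)
    (hTS : ∀ c, c ∉ h.below L → S c = T c) : SST m (L + 1) Y S where
  lt c hc := by
    by_cases hc' : c ∈ h.below L
    · exact (hS.lt c hc').trans (Nat.lt_succ_self L)
    · exact hTS c hc' ▸ h.lt c hc
  row {i j j'} hc hj := by
    by_cases hc' : (i, j') ∈ h.below L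
    · exact hS.row hc' hj
    · rw [hTS _ hc']
      by_cases hd : (i, j) ∈ h.below L
      · have h1 := hS.lt _ hd
        have h2 := h.eq_of_not_mem_below hc hc'
        omega
      · rw [hTS _ hd]
        exact h.row hc hj
  col {i i' j} hc hi := by
    by_cases hc' : (i', j) ∈ h.below L
    · exact hS.col hc' hi
    · rw [hTS _ hc']
      by_cases hd : (i, j) ∈ h.below L
      · have h1 := hS.lt _ hd
        have h2 := h.eq_of_not_mem_below hc hc'
        omega
      · rw [hTS _ hd]
        exact h.col hc hi

end SST

theorem sst_highestFilling {m L : ℕ} {Y : YoungDiagram} (h : ∀ c ∈ Y, highestFilling m c < L) :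
    SST m L Y (highestFilling m) where
  lt := h
  row := by
    intro i j j' _ _
    simp only [highestFilling]
    split_ifs <;> omega
  col := by
    intro i i' j _ _
    simp only [highestFilling]
    split_ifs <;> omega

/-- In the listing of the boxes by increasing `ρ`, each letter `a'` before the box `c` is matched
with a later letter `a` before `c`, and each letter `a` after `c` is matched with an earlier letter
`a'` after `c`. -/
def Unmatched (Y : YoungDiagram) (ρ : ℕ × ℕ → ℕ) (T : ℕ × ℕ → ℕ) (c : ℕ × ℕ) (a a' : ℕ) : Prop :=
  (∀ t, (Y.cells.filter fun d => T d = a' ∧ t ≤ ρ d ∧ ρ d < ρ c).card ≤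
    (Y.cells.filter fun d => T d = a ∧ t ≤ ρ d ∧ ρ d < ρ c).card) ∧
  (∀ t, (Y.cells.filter fun d => T d = a ∧ ρ c < ρ d ∧ ρ d < t).card ≤
    (Y.cells.filter fun d => T d = a' ∧ ρ c < ρ d ∧ ρ d < t).card)

/-- As `g` moves boxes later and `h` moves them earlier, one matching serves for all cut-offs `t` at
once. -/
theorem Unmatched.of_injOn {Y : YoungDiagram} {ρ T : ℕ × ℕ → ℕ} {c : ℕ × ℕ} {a a' : ℕ}
    (g h : ℕ × ℕ → ℕ × ℕ)
    (hg : ∀ d ∈ Y, T d = a' → ρ d < ρ c → g d ∈ Y ∧ T (g d) = a ∧ ρ d ≤ ρ (g d) ∧ ρ (g d) < ρ c)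
    (hg' : Set.InjOn g {d | d ∈ Y ∧ T d = a' ∧ ρ d < ρ c})
    (hh : ∀ d ∈ Y, T d = a → ρ c < ρ d → h d ∈ Y ∧ T (h d) = a' ∧ ρ c < ρ (h d) ∧ ρ (h d) ≤ ρ d)
    (hh' : Set.InjOn h {d | d ∈ Y ∧ T d = a ∧ ρ c < ρ d}) : Unmatched Y ρ T c a a' := by
  constructor
  · intro t
    refine Finset.card_le_card_of_injOn g ?_ (hg'.mono ?_)
    · intro d hd
      simp only [Finset.coe_filter, YoungDiagram.mem_cells, Set.mem_ofPred_eq] at hd ⊢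
      have := hg d hd.1 hd.2.1 hd.2.2.2
      exact ⟨this.1, this.2.1, hd.2.2.1.trans this.2.2.1, this.2.2.2⟩
    · intro d hd
      simp only [Finset.coe_filter, YoungDiagram.mem_cells, Set.mem_ofPred_eq] at hd ⊢
      exact ⟨hd.1, hd.2.1, hd.2.2.2⟩
  · intro t
    refine Finset.card_le_card_of_injOn h ?_ (hh'.mono ?_)
    · intro d hd
      simp only [Finset.coe_filter, YoungDiagram.mem_cells, Set.mem_ofPred_eq] at hd ⊢
      have := hh d hd.1 hd.2.1 hd.2.2.1
      exact ⟨this.1, this.2.1, this.2.2.1, this.2.2.2.trans_lt hd.2.2.2⟩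
    · intro d hd
      simp only [Finset.coe_filter, YoungDiagram.mem_cells, Set.mem_ofPred_eq] at hd ⊢
      exact ⟨hd.1, hd.2.1, hd.2.2.1⟩

theorem Unmatched.extend {Y Y' : YoungDiagram} {ρ T : ℕ × ℕ → ℕ} {c : ℕ × ℕ} {a a' : ℕ}
    (h : Unmatched Y' ρ T c a a') (hsub : ∀ d ∈ Y', d ∈ Y)
    (hne : ∀ d ∈ Y, d ∉ Y' → T d ≠ a ∧ T d ≠ a') : Unmatched Y ρ T c a a' := by
  have key : ∀ (x : ℕ) (P : ℕ × ℕ → Prop) [DecidablePred P], (x = a ∨ x = a') →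
      (Y.cells.filter fun d => T d = x ∧ P d) = (Y'.cells.filter fun d => T d = x ∧ P d) := by
    intro x P _ hx
    ext d
    simp only [Finset.mem_filter, YoungDiagram.mem_cells]
    refine ⟨fun hd => ⟨?_, hd.2⟩, fun hd => ⟨hsub d hd.1, hd.2⟩⟩
    by_contra hd'
    have := hne d hd.1 hd'
    rcases hx with rfl | rfl
    · exact this.1 hd.2.1
    · exact this.2 hd.2.1
  constructor
  · intro t
    rw [key a' _ (Or.inr rfl), key a _ (Or.inl rfl)]
    exact h.1 t
  · intro t
    rw [key a' _ (Or.inr rfl), key a _ (Or.inl rfl)]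
    exact h.2 t

/-- The operator `f̃_i` acts on the letter `i` in the box `c`. -/
def Acts (m : ℕ) (Y : YoungDiagram) (ρ T : ℕ × ℕ → ℕ) (c : ℕ × ℕ) (i : ℕ) : Prop :=
  T c = i ∧ ((i + 1 < m ∧ Unmatched Y ρ T c (i + 1) i) ∨
    (i + 1 = m ∧ ∀ d ∈ Y, ρ d < ρ c → T d ≠ i ∧ T d ≠ i + 1) ∨
    (m < i + 1 ∧ Unmatched Y ρ T c i (i + 1)))

theorem Acts.extend {m : ℕ} {Y Y' : YoungDiagram} {ρ T : ℕ × ℕ → ℕ} {c : ℕ × ℕ} {i : ℕ}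
    (h : Acts m Y' ρ T c i) (hsub : ∀ d ∈ Y', d ∈ Y)
    (hne : ∀ d ∈ Y, d ∉ Y' → T d ≠ i ∧ T d ≠ i + 1) : Acts m Y ρ T c i := by
  refine ⟨h.1, ?_⟩
  rcases h.2 with ⟨h1, h2⟩ | ⟨h1, h2⟩ | ⟨h1, h2⟩
  · exact Or.inl ⟨h1, h2.extend hsub fun d hd hd' => (hne d hd hd').symm⟩
  · refine Or.inr (Or.inl ⟨h1, fun d hd hlt => ?_⟩)
    by_cases hd' : d ∈ Y'
    · exact h2 d hd' hlt
    · exact hne d hd hd'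
  · exact Or.inr (Or.inr ⟨h1, h2.extend hsub hne⟩)

/-- The arrows of the crystal graph of `B(Y)`, for fillings of the whole quadrant. -/
def Step (m L : ℕ) (Y : YoungDiagram) (ρ : ℕ × ℕ → ℕ) (T T' : ℕ × ℕ → ℕ) : Prop :=
  SST m L Y T ∧ SST m L Y T' ∧
    ∃ c ∈ Y, ∃ i, Acts m Y ρ T c i ∧ T' = Function.update T c (i + 1)

variable {m L : ℕ} {Y : YoungDiagram} {ρ T T' A B : ℕ × ℕ → ℕ}

theorem Step.eq_off {Y' : YoungDiagram} (h : Step m L Y' ρ A B) : ∀ c, c ∉ Y' → A c = B c := by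
  obtain ⟨_, _, c, hc, i, _, rfl⟩ := h
  intro d hd
  rw [Function.update_of_ne]
  rintro rfl
  exact hd hc

/-- The new boxes contain `L`, whereas the step uses only `i` and `i + 1 < L`, so the signature is
unchanged. -/
theorem Step.extend (hT : SST m (L + 1) Y T) (h : Step m L (hT.below L) ρ A B)
    (hA : ∀ c, c ∉ hT.below L → A c = T c) : Step m (L + 1) Y ρ A B := by
  have hB : ∀ c, c ∉ hT.below L → B c = T c := fun c hc => (h.eq_off c hc).symm.trans (hA c hc)
  obtain ⟨h1, h2, c, hc, i, h3, h4⟩ := h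
  refine ⟨hT.glue h1 hA, hT.glue h2 hB, c, (hT.mem_below.1 hc).1, i, ?_, h4⟩
  have hi : i + 1 < L := by
    have := h2.lt c hc
    rwa [h4, Function.update_self] at this
  refine h3.extend (fun d hd => (hT.mem_below.1 hd).1) fun d hd hd' => ?_
  rw [hA d hd', hT.eq_of_not_mem_below hd hd']
  omega

/-- Both conclusions are proved together: agreement off the smaller diagram has to be transported
along the chain before a reversed or later step can be extended. -/
theorem eqvGen_extend (hT : SST m (L + 1) Y T)
    (h : Relation.EqvGen (Step m L (hT.below L) ρ) A B) :
    (∀ c, c ∉ hT.below L → A c = B c) ∧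
      ((∀ c, c ∉ hT.below L → A c = T c) → Relation.EqvGen (Step m (L + 1) Y ρ) A B) := by
  induction h with
  | rel A B h => exact ⟨h.eq_off, fun hA => .rel _ _ (h.extend hT hA)⟩
  | refl A => exact ⟨fun _ _ => rfl, fun _ => .refl _⟩
  | symm A B _ ih =>
    exact ⟨fun c hc => (ih.1 c hc).symm,
      fun hB => .symm _ _ (ih.2 fun c hc => (ih.1 c hc).trans (hB c hc))⟩
  | trans A B C _ _ ih1 ih2 =>
    exact ⟨fun c hc => (ih1.1 c hc).trans (ih2.1 c hc), fun hA => .trans _ _ _ (ih1.2 hA)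
      (ih2.2 fun c hc => (ih1.1 c hc).symm.trans (hA c hc))⟩

/-- `T'` is a semistandard filling in the component of `T`. -/
def Linked (m L : ℕ) (Y : YoungDiagram) (ρ T T' : ℕ × ℕ → ℕ) : Prop :=
  Relation.EqvGen (Step m L Y ρ) T T' ∧ SST m L Y T' ∧ ∀ c, c ∉ Y → T c = T' c

theorem exists_linked_of_measure (μ : (ℕ × ℕ → ℕ) → ℕ) (P : (ℕ × ℕ → ℕ) → Prop)
    (h : ∀ T, SST m L Y T → ¬ P T → ∃ T', Linked m L Y ρ T T' ∧ μ T' < μ T) :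
    ∀ T, SST m L Y T → ∃ T', Linked m L Y ρ T T' ∧ P T' := by
  intro T
  induction hk : μ T using Nat.strong_induction_on generalizing T with
  | _ k ih =>
    intro hT
    by_cases hP : P T
    · exact ⟨T, ⟨.refl _, hT, fun _ _ => rfl⟩, hP⟩
    · obtain ⟨T1, h1, h2⟩ := h T hT hP
      obtain ⟨T2, h3, h4⟩ := ih (μ T1) (hk ▸ h2) T1 rfl h1.2.1
      exact ⟨T2, ⟨.trans _ _ _ h1.1 h3.1, h3.2.1,
        fun c hc => (h1.2.2 c hc).trans (h3.2.2 c hc)⟩, h4⟩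

/-- All semistandard fillings of any diagram with letters below `L` are linked. -/
def AllLinked (m L : ℕ) (ρ : ℕ × ℕ → ℕ) (Y : YoungDiagram) : Prop :=
  ∀ T T', SST m L Y T → SST m L Y T' → (∀ c, c ∉ Y → T c = T' c) →
    Relation.EqvGen (Step m L Y ρ) T T'

theorem linked_of_below (hT : SST m (L + 1) Y T) (hL : AllLinked m L ρ (hT.below L))
    {S : ℕ × ℕ → ℕ} (hS : SST m L (hT.below L) S) (hTS : ∀ c, c ∉ hT.below L → S c = T c) :
    Linked m (L + 1) Y ρ T S :=
  ⟨(eqvGen_extend hT (hL T S (hT.restrict_below L) hS fun c hc => (hTS c hc).symm)).2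
    fun _ _ => rfl, hT.glue hS hTS,
    fun c hc => (hTS c fun hc' => hc (hT.mem_below.1 hc').1).symm⟩

end SuperCrystal
-- Moving the largest letter to its canonical boxes.
namespace SuperCrystal

variable {m L : ℕ} {Y : YoungDiagram} {ρ T : ℕ × ℕ → ℕ}

/-- `ρ` lists strictly higher boxes of `Y` first. -/
def ReadsHigherFirst (Y : YoungDiagram) (ρ : ℕ × ℕ → ℕ) : Prop :=
  ∀ c ∈ Y, ∀ d ∈ Y, StrictlyHigher c d → ρ c < ρ d

theorem StrictlyHigher.mk {i i' j j' : ℕ} (hi : i ≤ i') (hj : j' ≤ j) (h : i < i' ∨ j' < j) :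
    StrictlyHigher (i, j) (i', j') := by
  refine ⟨?_, hi, hj⟩
  simp only [ne_eq, Prod.mk.injEq]
  omega

/-- If a letter `l + 1 ≤ m` stands too high, then the number of letters `l + 1` can be reduced. -/
theorem exists_linked_fewer {l : ℕ} (hρ : ReadsHigherFirst Y ρ) (hLm : l + 1 ≤ m)
    (hT : SST m (l + 2) Y T) (hIH : AllLinked m (l + 1) ρ (hT.below (l + 1)))
    (hz : ∃ c ∈ Y, T c = l + 1 ∧ c.1 < l + 1) :
    ∃ T', Linked m (l + 2) Y ρ T T' ∧
      (Y.cells.filter fun c => T' c = l + 1).card < (Y.cells.filter fun c => T c = l + 1).card := by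
  classical
  set Y' := hT.below (l + 1) with hY'
  have hmem : ∀ {c}, c ∈ Y' ↔ c ∈ Y ∧ T c < l + 1 := hT.mem_below
  have hHY' : ∀ c ∈ Y', highestFilling m c = c.1 ∧ c.1 < l + 1 := by
    intro c hc
    have h1 := hT.highestFilling_le (hmem.1 hc).1
    have h2 := (hmem.1 hc).2
    unfold highestFilling at h1 ⊢
    split_ifs at h1 ⊢ <;> omega
  -- the box to be changed
  obtain ⟨c₀, hc₀, hTc₀, hc₀l, hext⟩ : ∃ c₀ ∈ Y, T c₀ = l + 1 ∧ c₀.1 < l + 1 ∧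
      ∀ d ∈ Y, T d = l + 1 → d.1 < l + 1 →
        (l + 1 < m → ρ d ≤ ρ c₀) ∧ (l + 1 = m → ρ c₀ ≤ ρ d) := by
    have hne : (Y.cells.filter fun c => T c = l + 1 ∧ c.1 < l + 1).Nonempty := by
      obtain ⟨c, hc⟩ := hz
      exact ⟨c, by simpa using hc⟩
    -- An odd operator acts on the first relevant letter, so the first box is taken if `l + 1 = m`.
    -- For an even operator the `-` that survives is the last one, so the last box is taken.
    rcases hLm.eq_or_lt with h | h
    · obtain ⟨c, hc, hmin⟩ := Finset.exists_min_image _ ρ hne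
      simp only [Finset.mem_filter, YoungDiagram.mem_cells] at hc hmin
      exact ⟨c, hc.1, hc.2.1, hc.2.2, fun d hd h1 h2 =>
        ⟨fun h3 => by omega, fun _ => hmin d ⟨hd, h1, h2⟩⟩⟩
    · obtain ⟨c, hc, hmax⟩ := Finset.exists_max_image _ ρ hne
      simp only [Finset.mem_filter, YoungDiagram.mem_cells] at hc hmax
      exact ⟨c, hc.1, hc.2.1, hc.2.2, fun d hd h1 h2 =>
        ⟨fun _ => hmax d ⟨hd, h1, h2⟩, fun h3 => by omega⟩⟩
  obtain ⟨p, q⟩ := c₀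
  simp only at hc₀l
  have hc₀' : (p, q) ∉ Y' := fun h => by have := (hmem.1 h).2; omega
  -- letters `l` at the bottom of `Y'` come after the box
  have hprev : ∀ j, (l, j) ∈ Y' → ρ (p, q) < ρ (l, j) := by
    intro j hj
    refine hρ _ hc₀ _ (hmem.1 hj).1 (StrictlyHigher.mk (by omega) ?_ (Or.inr ?_))
    all_goals
      by_contra hjq
      have h1 := hT.mono (hmem.1 hj).1 (show p ≤ l by omega) (show q ≤ j by omega)
      have h2 := (hmem.1 hj).2
      omega
  -- By induction the part below `l + 1` may be made highest. Since its letters are below `m`, each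
  -- then equals its row index, and `l` occurs in it only in row `l`.
  set S : ℕ × ℕ → ℕ := fun c => if c ∈ Y' then highestFilling m c else T c with hSdef
  have hSin : ∀ c ∈ Y', S c = c.1 := fun c hc => by
    rw [hSdef]; simp only [hc, if_true]; exact (hHY' c hc).1
  have hSout : ∀ c, c ∉ Y' → S c = T c := fun c hc => by rw [hSdef]; simp only [hc, if_false]
  have hSY' : SST m (l + 1) Y' S :=
    (sst_highestFilling fun c hc => by have := hHY' c hc; omega).congr
      fun c hc => ((hHY' c hc).1.trans (hSin c hc).symm)
  have hS := linked_of_below hT hIH hSY' hSout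
  have hSz : ∀ c ∈ Y, S c = l + 1 → T c = l + 1 := by
    intro c hc h
    by_cases hc' : c ∈ Y'
    · have := hSY'.lt c hc'; omega
    · rw [← hSout c hc', h]
  have hSz' : ∀ c ∈ Y, S c ≠ l + 1 → c ∈ Y' := by
    intro c hc h
    by_contra hc'
    exact h ((hSout c hc').trans (hT.eq_of_not_mem_below hc hc'))
  have hSc₀ : S (p, q) = l + 1 := (hSout _ hc₀').trans hTc₀
  have hSST := hS.2.1
  -- `f̃_l` takes `T1` back to `S`, so the link is traversed against the arrow.
  set T1 := Function.update S (p, q) l with hT1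
  have hT1ne : ∀ c, c ≠ (p, q) → T1 c = S c := fun c hc => Function.update_of_ne hc _ _
  have hT1c₀ : T1 (p, q) = l := Function.update_self _ _ _
  have hT1SST : SST m (l + 2) Y T1 := by
    constructor
    · intro c hc
      by_cases h : c = (p, q)
      · rw [h, hT1c₀]; omega
      · rw [hT1ne c h]; exact hSST.lt c hc
    · intro i j j' hc hj
      have h0 := hSST.row hc hj
      by_cases h1 : (i, j') = (p, q)
      · obtain ⟨rfl, rfl⟩ := Prod.mk.inj h1
        rw [hT1c₀, hT1ne (i, j) (by simp; omega)]
        -- Another `l + 1` to the left would repeat an element of `𝐁₋` in the row if `l + 1 = m`,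
        -- and would be read later than the chosen last box otherwise.
        have h2 : S (i, j) ≠ l + 1 := by
          intro h2
          have hd := Y.up_left_mem le_rfl hj.le hc
          have h3 := hext (i, j) hd (hSz _ hd h2) hc₀l
          have h4 := hρ _ hc _ hd (StrictlyHigher.mk le_rfl hj.le (Or.inr hj))
          rcases hLm.eq_or_lt with h | h
          · have := h0.2 (h2.trans hSc₀.symm)
            omega
          · have := h3.1 h
            omega
        omega
      · rw [hT1ne _ h1]
        by_cases h2 : (i, j) = (p, q)
        · rw [h2] at h0 ⊢
          rw [hT1c₀]
          omega
        · rw [hT1ne _ h2]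
          exact h0
    · intro i i' j hc hi
      have h0 := hSST.col hc hi
      by_cases h1 : (i', j) = (p, q)
      · obtain ⟨rfl, rfl⟩ := Prod.mk.inj h1
        rw [hT1c₀, hT1ne (i, j) (by simp; omega)]
        have hd := Y.up_left_mem hi.le le_rfl hc
        have h2 : S (i, j) ≠ l + 1 := by
          intro h2
          have h3 := hext (i, j) hd (hSz _ hd h2) (by simp only; omega)
          have h4 := hρ _ hd _ hc (StrictlyHigher.mk hi.le le_rfl (Or.inl hi))
          rcases hLm.eq_or_lt with h | h
          · have := h3.2 h
            omega
          · have := h0.2 (h2.trans hSc₀.symm)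
            omega
        have h5 := hSin _ (hSz' _ hd h2)
        simp only at h5
        omega
      · rw [hT1ne _ h1]
        by_cases h2 : (i, j) = (p, q)
        · rw [h2] at h0 ⊢
          rw [hT1c₀]
          omega
        · rw [hT1ne _ h2]
          exact h0
  have hT1l : ∀ d ∈ Y, T1 d = l → d ≠ (p, q) → d.1 = l ∧ d ∈ Y' := by
    intro d hd h hne
    rw [hT1ne d hne] at h
    have h1 := hSz' d hd (by omega)
    exact ⟨(hSin d h1).symm.trans h, h1⟩
  have hbefore : ∀ d ∈ Y, T1 d = l → ¬ ρ d < ρ (p, q) := by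
    intro d hd h hlt
    have hne : d ≠ (p, q) := by rintro rfl; omega
    obtain ⟨h1, h2⟩ := hT1l d hd h hne
    obtain ⟨i, j⟩ := d
    simp only at h1
    subst h1
    have := hprev j h2
    omega
  have hTz : ∀ d ∈ Y, T1 d = l + 1 → T d = l + 1 ∧ d ≠ (p, q) := by
    intro d hd h
    have hne : d ≠ (p, q) := by rintro rfl; omega
    rw [hT1ne d hne] at h
    exact ⟨hSz d hd h, hne⟩
  have hacts : Acts m Y ρ T1 (p, q) l := by
    refine ⟨hT1c₀, ?_⟩
    rcases hLm.eq_or_lt with h | h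
    · refine Or.inr (Or.inl ⟨h, fun d hd hlt => ⟨fun h1 => hbefore d hd h1 hlt, fun h1 => ?_⟩⟩)
      obtain ⟨h2, hne⟩ := hTz d hd h1
      by_cases hdl : d.1 < l + 1
      · have := (hext d hd h2 hdl).2 h
        omega
      · have h3 := hT.highestFilling_le hd
        unfold highestFilling at h3
        rw [if_neg (by omega)] at h3
        obtain ⟨i, j⟩ := d
        simp only at h3 hdl
        have := hρ _ hc₀ _ hd (StrictlyHigher.mk (by omega) (by omega) (Or.inl (by omega)))
        omega
    -- No `l` precedes the box, so the first matching is vacuous. By the choice of the box, every `l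
    -- + 1` after it lies in row `l + 1`, and is matched with the `l` directly above.
    · refine Or.inl ⟨h, Unmatched.of_injOn id (fun d => (d.1 - 1, d.2))
        (fun d hd h1 hlt => absurd hlt (hbefore d hd h1)) Function.injective_id.injOn ?_ ?_⟩
      all_goals
        have hrow : ∀ d ∈ Y, T1 d = l + 1 → ρ (p, q) < ρ d → d.1 = l + 1 := by
          intro d hd h1 hlt
          obtain ⟨h2, hne⟩ := hTz d hd h1
          have h3 : ¬ d.1 < l + 1 := fun hdl => by
            have := (hext d hd h2 hdl).1 h
            omega
          have h4 := hT.highestFilling_le hd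
          unfold highestFilling at h4
          split_ifs at h4 <;> omega
      · rintro ⟨i, j⟩ hd h1 hlt
        have h2 := hrow _ hd h1 hlt
        simp only at h2
        subst h2
        have h3 := hT.col hd (Nat.lt_succ_self l)
        have h4 := (hTz _ hd h1).1
        have hu := Y.up_left_mem (Nat.le_succ l) le_rfl hd
        have h5 : (l, j) ∈ Y' := hmem.2 ⟨hu, by
          rcases h3.1.eq_or_lt with h6 | h6
          · have := h3.2 h6
            omega
          · omega⟩
        simp only [Nat.add_sub_cancel]
        have h6 : (l, j) ≠ (p, q) := fun h6 => hc₀' (h6 ▸ h5)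
        exact ⟨hu, (hT1ne _ h6).trans (hSin _ h5), hprev j h5,
          (hρ _ hu _ hd (StrictlyHigher.mk (Nat.le_succ l) le_rfl (Or.inl (by omega)))).le⟩
      · rintro ⟨i, j⟩ ⟨hd, h1, hlt⟩ ⟨i', j'⟩ ⟨hd', h1', hlt'⟩ heq
        have h2 := hrow _ hd h1 hlt
        have h2' := hrow _ hd' h1' hlt'
        simp only [Prod.mk.injEq] at h2 h2' heq ⊢
        omega
  have hstep : Step m (l + 2) Y ρ T1 S := by
    refine ⟨hT1SST, hSST, (p, q), hc₀, l, hacts, ?_⟩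
    rw [hT1, Function.update_idem, ← hSc₀, Function.update_eq_self]
  refine ⟨T1, ⟨.trans _ _ _ hS.1 (.symm _ _ (.rel _ _ hstep)), hT1SST, fun c hc => ?_⟩, ?_⟩
  · rw [hT1ne c (by rintro rfl; exact hc hc₀)]
    exact hS.2.2 c hc
  · refine Finset.card_lt_card (Finset.ssubset_iff_of_subset ?_ |>.2 ⟨(p, q), ?_, ?_⟩)
    · intro d
      simp only [Finset.mem_filter, YoungDiagram.mem_cells]
      exact fun h => ⟨h.1, (hTz d h.1 h.2).1⟩
    · simp [hc₀, hTc₀]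
    · simp [hT1c₀]

/-- If some row does not end in the letter `l + 1 > m`, then the number of letters `l + 1` can be
increased. -/
theorem exists_linked_more {l : ℕ} (hρ : ReadsHigherFirst Y ρ) (hml : m ≤ l)
    (hT : SST m (l + 2) Y T) (hIH : AllLinked m (l + 1) ρ (hT.below (l + 1)))
    (hz : ∃ c ∈ Y, (c.1, c.2 + 1) ∉ Y ∧ T c ≠ l + 1) :
    ∃ T', Linked m (l + 2) Y ρ T T' ∧
      (Y.cells.filter fun c => T' c ≠ l + 1).card < (Y.cells.filter fun c => T c ≠ l + 1).card := by
  classical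
  set Y' := hT.below (l + 1) with hY'
  have hmem : ∀ {c}, c ∈ Y' ↔ c ∈ Y ∧ T c < l + 1 := hT.mem_below
  have hlt : ∀ c ∈ Y, T c ≠ l + 1 → c ∈ Y' := by
    intro c hc h
    have := hT.lt c hc
    exact hmem.2 ⟨hc, by omega⟩
  obtain ⟨⟨p, q⟩, hc₀, hend, hTc₀, hmax⟩ : ∃ c₀ ∈ Y, (c₀.1, c₀.2 + 1) ∉ Y ∧ T c₀ ≠ l + 1 ∧
      ∀ d ∈ Y, (d.1, d.2 + 1) ∉ Y → T d ≠ l + 1 → d.1 ≤ c₀.1 := by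
    have hne : (Y.cells.filter fun c => (c.1, c.2 + 1) ∉ Y ∧ T c ≠ l + 1).Nonempty := by
      obtain ⟨c, hc⟩ := hz
      exact ⟨c, by simpa using hc⟩
    -- The lowest such row is chosen: all rows below it end in `l + 1`.
    obtain ⟨c, hc, hmax⟩ := Finset.exists_max_image _ Prod.fst hne
    simp only [Finset.mem_filter, YoungDiagram.mem_cells] at hc hmax
    exact ⟨c, hc.1, hc.2.1, hc.2.2, fun d hd h1 h2 => hmax d ⟨hd, h1, h2⟩⟩
  simp only at hend hmax
  have hc₀' := hlt _ hc₀ hTc₀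
  have hright : ∀ j, (p, j) ∈ Y → j ≤ q := by
    intro j hj
    by_contra h
    exact hend (Y.up_left_mem le_rfl (by omega) hj)
  -- Row ends of `Y'` receive `l`, which may repeat in columns because `m ≤ l`. A box with a right
  -- neighbour in `Y'` keeps its minimal letter, which is below `l`.
  set F : ℕ × ℕ → ℕ := fun c => if (c.1, c.2 + 1) ∈ Y' then highestFilling m c else l with hF
  have hFin : ∀ {i j}, (i, j + 1) ∈ Y' → F (i, j) = highestFilling m (i, j) := fun h => if_pos h
  have hFout : ∀ {i j}, (i, j + 1) ∉ Y' → F (i, j) = l := fun h => if_neg h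
  have hFle : ∀ {i j}, (i, j + 1) ∈ Y' →
      highestFilling m (i, j) < m ∨ highestFilling m (i, j) < l := by
    intro i j h
    have h1 := hT.highestFilling_le (hmem.1 h).1
    have h2 := (hmem.1 h).2
    unfold highestFilling at h1 ⊢
    split_ifs at h1 ⊢ <;> simp only at * <;> omega
  have hHSST : SST m (l + 1) Y' (highestFilling m) := sst_highestFilling fun c hc =>
    (hT.highestFilling_le (hmem.1 hc).1).trans_lt (hmem.1 hc).2
  have hFSST : SST m (l + 1) Y' F := by
    constructor
    · rintro ⟨i, j⟩ hc
      by_cases h : (i, j + 1) ∈ Y'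
      · rw [hFin h]; exact hHSST.lt _ hc
      · rw [hFout h]; omega
    · intro i j j' hc hj
      have h1 : (i, j + 1) ∈ Y' := Y'.up_left_mem le_rfl hj hc
      rw [hFin h1]
      by_cases h : (i, j' + 1) ∈ Y'
      · rw [hFin h]; exact hHSST.row hc hj
      · rw [hFout h]
        have := hFle h1
        omega
    · intro i i' j hc hi
      by_cases h : (i', j + 1) ∈ Y'
      · rw [hFin h, hFin (Y'.up_left_mem hi.le le_rfl h)]
        exact hHSST.col hc hi
      · rw [hFout h]
        by_cases h1 : (i, j + 1) ∈ Y'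
        · rw [hFin h1]
          have := hFle h1
          omega
        · rw [hFout h1]
          omega
  set S : ℕ × ℕ → ℕ := fun c => if c ∈ Y' then F c else T c with hSdef
  have hSin : ∀ c ∈ Y', S c = F c := fun c hc => by rw [hSdef]; simp only [hc, if_true]
  have hSout : ∀ c, c ∉ Y' → S c = T c := fun c hc => by rw [hSdef]; simp only [hc, if_false]
  have hSY' : SST m (l + 1) Y' S := hFSST.congr fun c hc => (hSin c hc).symm
  have hS := linked_of_below hT hIH hSY' hSout
  have hSST := hS.2.1
  have hSz : ∀ c ∈ Y, T c = l + 1 → S c = l + 1 := by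
    intro c hc h
    rw [hSout c (fun hc' => by have := (hmem.1 hc').2; omega), h]
  have hSz' : ∀ c ∈ Y, S c = l + 1 → T c = l + 1 := by
    intro c hc h
    by_contra h1
    have := hSY'.lt c (hlt c hc h1)
    omega
  have hSc₀ : S (p, q) = l := by
    rw [hSin _ hc₀', hFout fun h => hend (hmem.1 h).1]
  -- a letter `l + 1` is at the end of its row, with a letter `l` in front of it
  have hzend : ∀ i j, T (i, j) = l + 1 → (i, j + 1) ∉ Y := by
    intro i j h h1
    have h2 := hT.row h1 (Nat.lt_succ_self j)
    have h3 := hT.lt _ h1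
    omega
  set T1 := Function.update S (p, q) (l + 1) with hT1
  have hT1ne : ∀ c, c ≠ (p, q) → T1 c = S c := fun c hc => Function.update_of_ne hc _ _
  have hT1c₀ : T1 (p, q) = l + 1 := Function.update_self _ _ _
  have hT1SST : SST m (l + 2) Y T1 := by
    constructor
    · intro c hc
      by_cases h : c = (p, q)
      · rw [h, hT1c₀]; omega
      · rw [hT1ne c h]; exact hSST.lt c hc
    · intro i j j' hc hj
      have h0 := hSST.row hc hj
      by_cases h1 : (i, j') = (p, q)
      · rw [h1] at h0 ⊢
        rw [hT1c₀, hT1ne (i, j) (by rw [← h1]; simp; omega)]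
        omega
      · rw [hT1ne _ h1]
        by_cases h2 : (i, j) = (p, q)
        · obtain ⟨rfl, rfl⟩ := Prod.mk.inj h2
          have := hright j' hc
          omega
        · rw [hT1ne _ h2]
          exact h0
    · intro i i' j hc hi
      have h0 := hSST.col hc hi
      by_cases h1 : (i', j) = (p, q)
      · rw [h1] at h0 ⊢
        rw [hT1c₀, hT1ne (i, j) (by rw [← h1]; simp; omega)]
        omega
      · rw [hT1ne _ h1]
        by_cases h2 : (i, j) = (p, q)
        · obtain ⟨rfl, rfl⟩ := Prod.mk.inj h2
          rw [hT1c₀]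
          -- A box of `Y` below the row end `(p, q)` is again a row end, in a lower row.
          have h3 : T (i', j) = l + 1 := by
            by_contra h3
            have := hmax (i', j) hc (fun h4 => hend (Y.up_left_mem hi.le le_rfl h4)) h3
            simp only at this
            omega
          rw [hSz _ hc h3]
          omega
        · rw [hT1ne _ h2]
          exact h0
  have hacts : Acts m Y ρ S (p, q) l := by
    refine ⟨hSc₀, Or.inr (Or.inr ⟨by omega, ?_⟩)⟩
    have hbef : ∀ i j, (i, j) ∈ Y → S (i, j) = l + 1 → ρ (i, j) < ρ (p, q) → i < p ∧ q < j := by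
      intro i j hd h1 hlt'
      have h2 := hSz' _ hd h1
      have hip : i < p := by
        by_contra hip
        have hjq := hright j (Y.up_left_mem (not_lt.1 hip) le_rfl hd)
        by_cases heq : i = p ∧ j = q
        · obtain ⟨rfl, rfl⟩ := heq
          omega
        · have := hρ _ hc₀ _ hd (StrictlyHigher.mk (not_lt.1 hip) hjq (by omega))
          omega
      refine ⟨hip, ?_⟩
      by_contra hjq
      rcases (not_lt.1 hjq).eq_or_lt with rfl | hjq
      · have h3 := (hT.col hc₀ hip).1
        have h4 := (hmem.1 hc₀').2
        omega
      · exact hzend _ _ h2 (Y.up_left_mem hip.le hjq hc₀)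
    -- An `l + 1` read before the box lies above and to the right of it, and is matched with the `l`
    -- on its left. An `l` read after the box ends a lower row of `Y'`; that row of `Y` ends in `l +
    -- 1`, so the right neighbour is its match.
    refine Unmatched.of_injOn (fun d => (d.1, d.2 - 1)) (fun d => (d.1, d.2 + 1)) ?_ ?_ ?_ ?_
    · rintro ⟨i, j⟩ hd h1 hlt'
      obtain ⟨hip, hjq⟩ := hbef i j hd h1 hlt'
      have h2 := hSz' _ hd h1
      obtain ⟨j, rfl⟩ : ∃ k, j = k + 1 := ⟨j - 1, by omega⟩
      simp only [Nat.add_sub_cancel]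
      have hu := Y.up_left_mem le_rfl (Nat.le_succ j) hd
      have h3 : (i, j) ∈ Y' := hlt _ hu fun h => hzend _ _ h hd
      refine ⟨hu, ?_, ?_, ?_⟩
      · rw [hSin _ h3, hFout]
        intro h4
        have := (hmem.1 h4).2
        omega
      · exact (hρ _ hd _ hu (StrictlyHigher.mk le_rfl (Nat.le_succ j) (by omega))).le
      · exact hρ _ hu _ hc₀ (StrictlyHigher.mk hip.le (by omega) (by omega))
    · rintro ⟨i, j⟩ ⟨hd, h1, hlt'⟩ ⟨i', j'⟩ ⟨hd', h1', hlt''⟩ heq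
      have h2 := hbef i j hd h1 hlt'
      have h2' := hbef i' j' hd' h1' hlt''
      simp only [Prod.mk.injEq] at heq ⊢
      omega
    · rintro ⟨i, j⟩ hd h1 hlt'
      have hd' : (i, j) ∈ Y' := by
        by_contra h
        have := hT.eq_of_not_mem_below hd h
        have := hSz _ hd this
        omega
      have h2 : (i, j + 1) ∉ Y' := by
        intro h
        rw [hSin _ hd', hFin h] at h1
        have := hFle h
        omega
      have hpi : p < i := by
        by_contra hpi
        have h3 : q ≤ j := by
          by_contra h3
          exact h2 (Y'.up_left_mem (not_lt.1 hpi) (by omega) hc₀')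
        by_cases heq : i = p ∧ j = q
        · obtain ⟨rfl, rfl⟩ := heq
          omega
        · have := hρ _ hd _ hc₀ (StrictlyHigher.mk (not_lt.1 hpi) h3 (by omega))
          omega
      have h3 : (i, j + 1) ∈ Y := by
        by_contra h3
        have h4 := (hmem.1 hd').2
        have := hmax (i, j) hd h3 (by omega)
        simp only at this
        omega
      have h4 := hright (j + 1) (Y.up_left_mem hpi.le le_rfl h3)
      exact ⟨h3, hSz _ h3 (hT.eq_of_not_mem_below h3 h2),
        hρ _ hc₀ _ h3 (StrictlyHigher.mk hpi.le h4 (Or.inl hpi)),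
        (hρ _ h3 _ hd (StrictlyHigher.mk le_rfl (Nat.le_succ j) (by omega))).le⟩
    · rintro ⟨i, j⟩ _ ⟨i', j'⟩ _ heq
      simp only [Prod.mk.injEq] at heq ⊢
      omega
  refine ⟨T1, ⟨.trans _ _ _ hS.1 (.rel _ _ ⟨hSST, hT1SST, (p, q), hc₀, l, hacts, rfl⟩), hT1SST,
    fun c hc => ?_⟩, ?_⟩
  · rw [hT1ne c (by rintro rfl; exact hc hc₀)]
    exact hS.2.2 c hc
  · refine Finset.card_lt_card (Finset.ssubset_iff_of_subset ?_ |>.2 ⟨(p, q), ?_, ?_⟩)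
    · intro d
      simp only [Finset.mem_filter, YoungDiagram.mem_cells]
      refine fun h => ⟨h.1, fun h1 => h.2 ?_⟩
      rw [hT1ne d (by rintro rfl; exact hTc₀ h1)]
      exact hSz d h.1 h1
    · simpa using ⟨hc₀, hTc₀⟩
    · simp [hT1c₀]

theorem allLinked_of_canonical (hL : ∀ Y' : YoungDiagram, (∀ c ∈ Y', c ∈ Y) → AllLinked m L ρ Y')
    (Q : ℕ × ℕ → Prop)
    (h : ∀ T, SST m (L + 1) Y T →
      ∃ T', Linked m (L + 1) Y ρ T T' ∧ ∀ c ∈ Y, (T' c = L ↔ Q c)) :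
    AllLinked m (L + 1) ρ Y := by
  intro T T' hT hT' hoff
  obtain ⟨A, hA, hAQ⟩ := h T hT
  obtain ⟨B, hB, hBQ⟩ := h T' hT'
  have hbelow : hB.2.1.below L = hA.2.1.below L := by
    ext c
    rw [YoungDiagram.mem_cells, YoungDiagram.mem_cells, SST.mem_below, SST.mem_below]
    refine and_congr_right fun hc => ?_
    have h1 := hA.2.1.lt c hc
    have h2 := hB.2.1.lt c hc
    have h3 := (hAQ c hc).trans (hBQ c hc).symm
    omega
  have hB' := hbelow ▸ hB.2.1.restrict_below L
  have hAB := linked_of_below (ρ := ρ) hA.2.1 (hL _ fun c hc => (hA.2.1.mem_below.1 hc).1) hB'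
    (fun c hc => by
      by_cases hcY : c ∈ Y
      · rw [hA.2.1.eq_of_not_mem_below hcY hc,
          hB.2.1.eq_of_not_mem_below hcY (hbelow.symm ▸ hc)]
      · rw [← hB.2.2 c hcY, ← hoff c hcY, hA.2.2 c hcY])
  exact .trans _ _ _ hA.1 (.trans _ _ _ hAB.1 (.symm _ _ hB.1))

theorem allLinked (m L : ℕ) (ρ : ℕ × ℕ → ℕ) :
    ∀ Y : YoungDiagram, ReadsHigherFirst Y ρ → AllLinked m L ρ Y := by
  induction L with
  | zero =>
    intro Y _ T T' hT _ h
    have : T = T' := funext fun c => h c fun hc => absurd (hT.lt c hc) (Nat.not_lt_zero _)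
    exact this ▸ .refl _
  | succ L ih =>
    intro Y hρ
    have hL : ∀ Y' : YoungDiagram, (∀ c ∈ Y', c ∈ Y) → AllLinked m L ρ Y' := fun Y' h =>
      ih Y' fun c hc d hd => hρ c (h c hc) d (h d hd)
    by_cases hLm : L ≤ m
    · refine allLinked_of_canonical hL (fun c => L ≤ c.1) fun T hT => ?_
      obtain ⟨T', h1, h2⟩ := exists_linked_of_measure (ρ := ρ)
        (fun T => (Y.cells.filter fun c => T c = L).card)
        (fun T => ∀ c ∈ Y, T c = L → L ≤ c.1) (fun T hT hP => by
          push Not at hP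
          obtain ⟨c, hc, h1, h2⟩ := hP
          obtain ⟨l, rfl⟩ : ∃ l, L = l + 1 := ⟨L - 1, by omega⟩
          exact exists_linked_fewer hρ hLm hT (hL _ fun c hc => (hT.mem_below.1 hc).1)
            ⟨c, hc, h1, h2⟩) T hT
      -- Conversely, minimality of the highest filling forces a letter `≥ L` in every row from `L`
      -- on.
      refine ⟨T', h1, fun c hc => ⟨h2 c hc, fun h3 => ?_⟩⟩
      have h4 := h1.2.1.highestFilling_le hc
      have h5 := h1.2.1.lt c hc
      unfold highestFilling at h4
      split_ifs at h4 <;> omega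
    · refine allLinked_of_canonical hL (fun c => (c.1, c.2 + 1) ∉ Y) fun T hT => ?_
      obtain ⟨T', h1, h2⟩ := exists_linked_of_measure (ρ := ρ)
        (fun T => (Y.cells.filter fun c => T c ≠ L).card)
        (fun T => ∀ c ∈ Y, (c.1, c.2 + 1) ∉ Y → T c = L) (fun T hT hP => by
          push Not at hP
          obtain ⟨c, hc, h1, h2⟩ := hP
          obtain ⟨l, rfl⟩ : ∃ l, L = l + 1 := ⟨L - 1, by omega⟩
          exact exists_linked_more hρ (by omega) hT (hL _ fun c hc => (hT.mem_below.1 hc).1)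
            ⟨c, hc, h1, h2⟩) T hT
      refine ⟨T', h1, fun c hc => ⟨fun h3 h4 => ?_, h2 c hc⟩⟩
      have h5 := h1.2.1.row h4 (Nat.lt_succ_self c.2)
      have h6 := h1.2.1.lt _ h4
      have h7 : T' (c.1, c.2) = L := h3
      omega

end SuperCrystal
-- From fillings back to tableaux and words.
namespace SuperCrystal

variable {m n : ℕ} {Y : YoungDiagram}

/-- The position of a box in a reading. -/
def Reading.position (r : Reading Y) (c : ℕ × ℕ) : ℕ :=
  if h : c ∈ Y.cells then (r.symm ⟨c, h⟩).1 else 0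

theorem Reading.position_apply (r : Reading Y) (k : Fin Y.card) : r.position (r k).1 = k.1 := by
  unfold Reading.position
  rw [dif_pos (r k).2]
  simp

theorem Admissible.readsHigherFirst {r : Reading Y} (hr : Admissible r) :
    ReadsHigherFirst Y r.position := by
  intro c hc d hd h
  rw [← YoungDiagram.mem_cells] at hc hd
  simp only [Reading.position, dif_pos hc, dif_pos hd]
  exact hr ⟨c, hc⟩ ⟨d, hd⟩ h

namespace Tableau

/-- The entries of a tableau as natural numbers, extended by `0` outside of its shape. -/
def fill (T : Tableau m n Y) (c : ℕ × ℕ) : ℕ := if h : c ∈ Y.cells then T.entry ⟨c, h⟩ else 0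

theorem fill_coe (T : Tableau m n Y) (c : {c : ℕ × ℕ // c ∈ Y.cells}) :
    T.fill c.1 = T.entry c := dif_pos c.2

theorem sst_fill (T : Tableau m n Y) : SST m (m + n) Y T.fill where
  lt c hc := by
    rw [← YoungDiagram.mem_cells] at hc
    rw [T.fill_coe ⟨c, hc⟩]
    exact Fin.is_lt _
  row {i j j'} hc hj := by
    have hd := Y.up_left_mem le_rfl hj.le hc
    rw [← YoungDiagram.mem_cells] at hc hd
    rw [T.fill_coe ⟨_, hc⟩, T.fill_coe ⟨_, hd⟩]
    exact ⟨T.row_le ⟨_, hd⟩ ⟨_, hc⟩ rfl hj, fun h => T.row_ne ⟨_, hd⟩ ⟨_, hc⟩ rfl hj (Fin.ext h)⟩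
  col {i i' j} hc hi := by
    have hd := Y.up_left_mem hi.le le_rfl hc
    rw [← YoungDiagram.mem_cells] at hc hd
    rw [T.fill_coe ⟨_, hc⟩, T.fill_coe ⟨_, hd⟩]
    exact ⟨T.col_le ⟨_, hd⟩ ⟨_, hc⟩ rfl hi, fun h => T.col_ne ⟨_, hd⟩ ⟨_, hc⟩ rfl hi (Fin.ext h)⟩

/-- The tableau of a semistandard filling. -/
def ofFill {A : ℕ × ℕ → ℕ} (hA : SST m (m + n) Y A) : Tableau m n Y where
  entry c := ⟨A c.1, hA.lt c.1 ((YoungDiagram.mem_cells _).1 c.2)⟩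
  row_le := by
    rintro ⟨⟨i, j⟩, _⟩ ⟨⟨i', j'⟩, hd⟩ h1 h2
    simp only at h1 h2
    subst h1
    exact (hA.row ((YoungDiagram.mem_cells _).1 hd) h2).1
  row_ne := by
    rintro ⟨⟨i, j⟩, _⟩ ⟨⟨i', j'⟩, hd⟩ h1 h2 h3
    simp only at h1 h2
    subst h1
    exact (hA.row ((YoungDiagram.mem_cells _).1 hd) h2).2 (Fin.mk.inj h3)
  col_le := by
    rintro ⟨⟨i, j⟩, _⟩ ⟨⟨i', j'⟩, hd⟩ h1 h2
    simp only at h1 h2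
    subst h1
    exact (hA.col ((YoungDiagram.mem_cells _).1 hd) h2).1
  col_ne := by
    rintro ⟨⟨i, j⟩, _⟩ ⟨⟨i', j'⟩, hd⟩ h1 h2 h3
    simp only at h1 h2
    subst h1
    exact (hA.col ((YoungDiagram.mem_cells _).1 hd) h2).2 (Fin.mk.inj h3)

theorem ofFill_fill (T : Tableau m n Y) : ofFill T.sst_fill = T := by
  ext c
  simp [ofFill, fill_coe]

end Tableau

theorem sum_reading (r : Reading Y) (g : ℕ × ℕ → ℤ) : ∑ k, g (r k).1 = ∑ c ∈ Y.cells, g c := by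
  rw [Equiv.sum_comp r (fun c => g c.1)]
  exact Finset.sum_coe_sort Y.cells g

/-- Translates the partial sums of the signature rule into the box counts of `Unmatched`. -/
theorem sum_sgn_reading (r : Reading Y) {A : ℕ × ℕ → ℕ} (hA : SST m (m + n) Y A)
    {a a' : Fin (m + n)} (hne : a ≠ a') (P : ℕ → Prop) [DecidablePred P] :
    ∑ k, (if P k.1 then sgn a a' ((Tableau.ofFill hA).entry (r k)) else 0) =
      ((Y.cells.filter fun d => A d = a.1 ∧ P (r.position d)).card : ℤ) -
        (Y.cells.filter fun d => A d = a'.1 ∧ P (r.position d)).card := by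
  rw [Finset.card_filter, Finset.card_filter]
  push_cast
  rw [← sum_reading r, ← sum_reading r, ← Finset.sum_sub_distrib]
  refine Finset.sum_congr rfl fun k _ => ?_
  have hne' : a.1 ≠ a'.1 := fun h => hne (Fin.ext h)
  simp only [r.position_apply, sgn, Tableau.ofFill, Fin.ext_iff]
  by_cases h1 : P k.1 <;> by_cases h2 : A (r k).1 = a.1 <;> by_cases h3 : A (r k).1 = a'.1 <;>
    simp [h1, h2, h3, hne', hne'.symm]

theorem Crystal.pure_injective : ∀ N : ℕ, Function.Injective (Crystal.pure (m := m) (n := n) N)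
  | 0, _, _, _ => funext fun k => k.elim0
  | N + 1, b, b', h => by
    obtain ⟨h1, h2⟩ := Prod.mk.inj h
    have h3 := Crystal.pure_injective N h2
    exact funext fun k => Fin.cases h1 (fun k => congrFun h3 k) k

theorem read_injective (r : Reading Y) :
    Function.Injective (read r : Tableau m n Y → _) := by
  intro T T' h
  have h1 := Crystal.pure_injective _ h
  ext c
  have := congrFun h1 (r.symm c)
  simp only [Equiv.apply_symm_apply] at this
  rw [this]

theorem f_ofFill {r : Reading Y} {A B : ℕ × ℕ → ℕ} (hA : SST m (m + n) Y A)
    (hB : SST m (m + n) Y B) {c : ℕ × ℕ} (hc : c ∈ Y) {i : Idx m n}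
    (hacts : Acts m Y r.position A c i.1) (hAB : B = Function.update A c (i.1 + 1)) :
    (crystalOf m n Y r).f i (Tableau.ofFill hA) = some (Tableau.ofFill hB) := by
  have hc' : c ∈ Y.cells := (YoungDiagram.mem_cells _).2 hc
  obtain ⟨k, hk⟩ : ∃ k, r k = ⟨c, hc'⟩ := ⟨r.symm ⟨c, hc'⟩, by simp⟩
  have hpos : r.position c = k.1 := by rw [← r.position_apply k, hk]
  have hsrc : (Tableau.ofFill hA).entry (r k) = i.src := by
    rw [hk]
    exact Fin.ext hacts.1
  have key : (Crystal.tensorPow m n Y.card).f i (read r (Tableau.ofFill hA)) =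
      some (Crystal.pure Y.card
        (Function.update (fun k => (Tableau.ofFill hA).entry (r k)) k i.tgt)) := by
    have hne := Crystal.src_ne_tgt i
    rcases hacts.2 with ⟨hi, h1, h2⟩ | ⟨hi, h1⟩ | ⟨hi, h1, h2⟩
    · refine Crystal.f_pure_of_pos hi _ k hsrc (fun t => ?_) (fun t => ?_)
      · have h3 := h1 t
        rw [hpos] at h3
        have h4 := sum_sgn_reading r hA hne.symm (fun j => t ≤ j ∧ j < k.1)
        simp only [Fin.lt_def] at h4 ⊢
        rw [h4]
        exact sub_nonneg.2 (Nat.cast_le.2 h3)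
      · have h3 := h2 t
        rw [hpos] at h3
        have h4 := sum_sgn_reading r hA hne.symm (fun j => k.1 < j ∧ j < t)
        simp only [Fin.lt_def] at h4 ⊢
        rw [h4]
        exact sub_nonpos.2 (Nat.cast_le.2 h3)
    · refine Crystal.f_pure_of_odd hi _ k hsrc fun j hj => ?_
      have h2 := h1 (r j).1 ((YoungDiagram.mem_cells _).1 (r j).2)
        (by rw [r.position_apply, hpos]; exact hj)
      exact ⟨fun h => h2.1 (Fin.ext_iff.1 h), fun h => h2.2 (Fin.ext_iff.1 h)⟩
    · refine Crystal.f_pure_of_neg hi _ k hsrc (fun t => ?_) (fun t => ?_)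
      · have h3 := h1 t
        rw [hpos] at h3
        have h4 := sum_sgn_reading r hA hne (fun j => t ≤ j ∧ j < k.1)
        simp only [Fin.lt_def] at h4 ⊢
        rw [h4]
        exact sub_nonneg.2 (Nat.cast_le.2 h3)
      · have h3 := h2 t
        rw [hpos] at h3
        have h4 := sum_sgn_reading r hA hne (fun j => k.1 < j ∧ j < t)
        simp only [Fin.lt_def] at h4 ⊢
        rw [h4]
        exact sub_nonpos.2 (Nat.cast_le.2 h3)
  have hread : Crystal.pure Y.card
      (Function.update (fun k => (Tableau.ofFill hA).entry (r k)) k i.tgt) =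
      read r (Tableau.ofFill hB) := by
    refine congrArg _ (funext fun j => Fin.ext ?_)
    by_cases hj : j = k
    · subst hj
      simp [Tableau.ofFill, hk, hAB, Idx.tgt]
    · have hne : (r j).1 ≠ c := fun h => hj (r.injective ((Subtype.ext h).trans hk.symm))
      rw [Function.update_of_ne hj]
      simp [Tableau.ofFill, hAB, Function.update_of_ne hne]
  change ((Crystal.tensorPow m n Y.card).f i (read r (Tableau.ofFill hA))).bind _ = _
  rw [key, hread]
  exact Function.partialInv_left (read_injective r) _

theorem reachable_of_step {r : Reading Y} {A B : ℕ × ℕ → ℕ}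
    (h : Step m (m + n) Y r.position A B) :
    (crystalOf m n Y r).graph.Reachable (Tableau.ofFill h.1) (Tableau.ofFill h.2.1) := by
  obtain ⟨hA, hB, c, hc, i, hacts, hAB⟩ := h
  have hi : i + 1 < m + n := by
    have := hB.lt c hc
    rwa [hAB, Function.update_self] at this
  refine SimpleGraph.Adj.reachable ?_
  refine (SimpleGraph.fromRel_adj _ _ _).2 ⟨fun h => ?_,
    Or.inl ⟨⟨i, hi⟩, f_ofFill hA hB hc hacts hAB⟩⟩
  have h1 := congrArg (fun T : Tableau m n Y => T.fill c) h
  have hc' : c ∈ Y.cells := (YoungDiagram.mem_cells _).2 hc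
  simp only [Tableau.fill, dif_pos hc', Tableau.ofFill] at h1
  rw [hAB, Function.update_self, hacts.1] at h1
  omega

theorem reachable_of_admissible {r : Reading Y} (hr : Admissible r) (T T' : Tableau m n Y) :
    (crystalOf m n Y r).graph.Reachable T T' := by
  classical
  have h := allLinked m (m + n) r.position Y hr.readsHigherFirst T.fill T'.fill T.sst_fill
    T'.sst_fill fun c hc => by
      rw [← YoungDiagram.mem_cells] at hc
      simp [Tableau.fill, hc]
  -- `Relation.EqvGen` is reflexive at arbitrary fillings, so a default tableau is needed off the
  -- semistandard ones.
  let g : (ℕ × ℕ → ℕ) → Tableau m n Y := fun A =>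
    if hA : SST m (m + n) Y A then Tableau.ofFill hA else T
  have hg : ∀ (A : ℕ × ℕ → ℕ) (hA : SST m (m + n) Y A), g A = Tableau.ofFill hA :=
    fun A hA => dif_pos hA
  have key : ∀ A B, Relation.EqvGen (Step m (m + n) Y r.position) A B →
      (crystalOf m n Y r).graph.Reachable (g A) (g B) := by
    intro A B hAB
    induction hAB with
    | rel A B hAB =>
      rw [hg A hAB.1, hg B hAB.2.1]
      exact reachable_of_step hAB
    | refl A => exact SimpleGraph.Reachable.refl _
    | symm A B _ ih => exact ih.symm
    | trans A B C _ _ ih1 ih2 => exact ih1.trans ih2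
  have := key _ _ h
  rwa [hg _ T.sst_fill, hg _ T'.sst_fill, Tableau.ofFill_fill, Tableau.ofFill_fill] at this

/-! ### Genuineness of `H_Y`. -/

/-- The sum of the positions of the letters, as a functional on the weight lattice. -/
def height (x : Weight m n) : ℤ := ∑ b, b.1 * x b

theorem height_eps (b : Fin (m + n)) : height (eps b : Weight m n) = b.1 := by
  unfold height eps
  rw [Finset.sum_eq_single b]
  · simp
  · intro c _ hc
    simp [hc]
  · simp

theorem height_sub (x y : Weight m n) : height (x - y) = height x - height y := by
  simp [height, mul_sub, Finset.sum_sub_distrib]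

theorem height_nonpos {x : Weight m n} (hx : x ∈ Qplus m n) : height x ≤ 0 := by
  induction hx using AddSubmonoid.closure_induction with
  | mem x hx =>
    obtain ⟨a, b, hab, rfl⟩ := hx
    rw [height_sub, height_eps, height_eps]
    have := Fin.lt_def.1 hab
    omega
  | zero => simp [height]
  | add x y _ _ hx hy =>
    have : height (x + y) = height x + height y := by
      simp [height, mul_add, Finset.sum_add_distrib]
    omega

theorem height_wt (r : Reading Y) (T : Tableau m n Y) :
    height ((crystalOf m n Y r).wt T) = ∑ c, ((T.entry c).1 : ℤ) := by
  have h : ∀ s : Finset {c : ℕ × ℕ // c ∈ Y.cells},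
      height (∑ c ∈ s, (eps (T.entry c) : Weight m n)) = ∑ c ∈ s, ((T.entry c).1 : ℤ) := by
    intro s
    simp only [height, Finset.sum_apply, Finset.mul_sum]
    rw [Finset.sum_comm]
    exact Finset.sum_congr rfl fun c _ => height_eps (T.entry c)
  exact h Finset.univ

theorem highestTableau_entry_le (hY : IsHook m n Y) (T : Tableau m n Y)
    (c : {c : ℕ × ℕ // c ∈ Y.cells}) : (highestTableau hY).entry c ≤ T.entry c := by
  have h := T.sst_fill.highestFilling_le ((YoungDiagram.mem_cells _).1 c.2)
  rw [T.fill_coe c] at h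
  rw [Fin.le_def]
  refine le_trans (le_of_eq ?_) h
  simp only [highestTableau, highestFilling]
  split_ifs <;> rfl

theorem isGenuineHighest_highestTableau (hY : IsHook m n Y) (r : Reading Y) :
    (crystalOf m n Y r).IsGenuineHighest (highestTableau hY) := by
  constructor
  · intro T hT
    have h1 := (height_wt r T).symm.trans ((congrArg height hT).trans (height_wt r _))
    -- Equal weights have equal heights, that is, equal entry sums; with entrywise domination this
    -- forces equal entries.
    have h2 := (Finset.sum_eq_sum_iff_of_le fun c _ => by
      exact_mod_cast highestTableau_entry_le hY T c).1 h1.symm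
    refine Tableau.ext (funext fun c => Fin.ext ?_)
    exact_mod_cast (h2 c (Finset.mem_univ c)).symm
  · intro T
    change (∑ c, eps ((highestTableau hY).entry c)) - (∑ c, eps (T.entry c)) ∈ Qplus m n
    rw [← Finset.sum_sub_distrib]
    refine AddSubmonoid.sum_mem _ fun c _ => ?_
    rcases (highestTableau_entry_le hY T c).eq_or_lt with h | h
    · rw [h, sub_self]
      exact AddSubmonoid.zero_mem _
    · exact AddSubmonoid.subset_closure ⟨_, _, h, rfl⟩

end SuperCrystal
-- Fake highest and lowest weight vectors for the staircase.
namespace SuperCrystal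

namespace Crystal

variable {m n : ℕ}

theorem sum_suffix_succ {N : ℕ} (g : Fin (N + 1) → ℤ) (t : ℕ) :
    ∑ j, (if t + 1 ≤ j.1 then g j else 0) = ∑ j : Fin N, (if t ≤ j.1 then g j.succ else 0) := by
  rw [Fin.sum_univ_succ]
  simp

theorem le_maxPartialSum_tail {a a' : Fin (m + n)} (hne : a ≠ a') {N : ℕ}
    {b : Fin (N + 1) → Fin (m + n)}
    (h : 0 ≤ ∑ j, (if 0 ≤ j.1 then sgn a a' (b j) else 0)) :
    (if b 0 = a' then 1 else 0) ≤ maxPartialSum a a' N (pure N fun k => b k.succ) := by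
  split_ifs with hb
  · have h1 := le_maxPartialSum a a' N (fun k => b k.succ) N
    rw [Fin.sum_univ_succ] at h
    simp only [Fin.is_lt, if_true] at h1
    simp only [zero_le, if_true] at h
    have h2 : sgn a a' (b 0) = -1 := by simp [sgn, hb, hne.symm]
    omega
  · exact Nat.zero_le _

theorem e_pure_eq_none_of_pos {i : Idx m n} (hi : i.1 + 1 < m) {N : ℕ} {b : Fin N → Fin (m + n)}
    (h : maxPartialSum i.tgt i.src N (pure N b) = 0) : (tensorPow m n N).e i (pure N b) = none :=
  HasDepth.eq_none (h ▸ hasDepth_e i hi N (pure N b))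

theorem f_pure_eq_none_of_neg {i : Idx m n} (hi : m < i.1 + 1) {N : ℕ} {b : Fin N → Fin (m + n)}
    (h : maxPartialSum i.src i.tgt N (pure N b) = 0) : (tensorPow m n N).f i (pure N b) = none :=
  HasDepth.eq_none (h ▸ hasDepth_f i hi N (pure N b))

/-- Nonnegative suffix sums make the tensor rule pass to the tail each time, down to the trivial
crystal. The bound `t < N` makes the hypothesis decidable for explicit words. -/
theorem e_pure_eq_none_of_neg {i : Idx m n} (hi : m < i.1 + 1) :
    ∀ {N : ℕ} (b : Fin N → Fin (m + n)),
      (∀ t < N, 0 ≤ ∑ j : Fin N, (if t ≤ j.1 then sgn i.src i.tgt (b j) else 0)) →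
      (tensorPow m n N).e i (pure N b) = none
  | 0, _, _ => rfl
  | N + 1, b, h => by
    have hphi : ∀ y, (tensorPow m n N).phi i y = maxPartialSum i.src i.tgt N y :=
      fun y => (hasDepth_f i hi N y).sSup_eq
    have ih := e_pure_eq_none_of_neg hi (fun k => b k.succ) fun t ht => by
      have := h (t + 1) (Nat.succ_lt_succ ht)
      rwa [sum_suffix_succ] at this
    change (tensor (vec m n) (tensorPow m n N)).e i (b 0, pure N fun k => b k.succ) = _
    simp only [tensor, hi.not_gt, hi.ne', if_false, vec_epsilon, hphi]
    rw [if_pos (le_maxPartialSum_tail (src_ne_tgt i) (h 0 (Nat.succ_pos N))), ih]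
    rfl

theorem f_pure_eq_none_of_pos {i : Idx m n} (hi : i.1 + 1 < m) :
    ∀ {N : ℕ} (b : Fin N → Fin (m + n)),
      (∀ t < N, 0 ≤ ∑ j : Fin N, (if t ≤ j.1 then sgn i.tgt i.src (b j) else 0)) →
      (tensorPow m n N).f i (pure N b) = none
  | 0, _, _ => rfl
  | N + 1, b, h => by
    have heps : ∀ y, (tensorPow m n N).epsilon i y = maxPartialSum i.tgt i.src N y :=
      fun y => (hasDepth_e i hi N y).sSup_eq
    have ih := f_pure_eq_none_of_pos hi (fun k => b k.succ) fun t ht => by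
      have := h (t + 1) (Nat.succ_lt_succ ht)
      rwa [sum_suffix_succ] at this
    change (tensor (vec m n) (tensorPow m n N)).f i (b 0, pure N fun k => b k.succ) = _
    simp only [tensor, hi, if_true, vec_phi, heps]
    rw [if_neg (le_maxPartialSum_tail (src_ne_tgt i).symm (h 0 (Nat.succ_pos N))).not_gt, ih]
    rfl

/-- The first letter among `i.src` and `i.tgt`, if any, is `i.src`; the operator acts there and
gives `0`. -/
theorem e_pure_eq_none_of_odd {i : Idx m n} (hi : i.1 + 1 = m) :
    ∀ {N : ℕ} (b : Fin N → Fin (m + n)), (∀ k, b k = i.tgt → ∃ j < k, b j = i.src) →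
      (tensorPow m n N).e i (pure N b) = none
  | 0, _, _ => rfl
  | N + 1, b, h => by
    change (tensor (vec m n) (tensorPow m n N)).e i (b 0, pure N fun k => b k.succ) = _
    simp only [tensor, hi, lt_irrefl, if_false, if_true]
    have h0 : b 0 ≠ i.tgt := fun h0 => by
      obtain ⟨j, hj, _⟩ := h 0 h0
      exact absurd hj (Fin.not_lt_zero j)
    have hp : 0 < pairing i ((vec m n).wt (b 0)) ↔ b 0 = i.src ∨ b 0 = i.tgt :=
      pairing_eps_pos_iff hi (b 0)
    by_cases hb : b 0 = i.src
    · have h1 : (vec m n).e i (b 0) = none := if_neg h0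
      rw [if_pos (hp.2 (Or.inl hb)), h1]
      rfl
    · have ih := e_pure_eq_none_of_odd hi (fun k => b k.succ) fun k hk => by
        obtain ⟨j, hj, hbj⟩ := h k.succ hk
        obtain ⟨j, rfl⟩ := Fin.exists_succ_eq.2 (fun hj0 : j = 0 => hb (hj0 ▸ hbj))
        exact ⟨j, Fin.succ_lt_succ_iff.1 hj, hbj⟩
      rw [if_neg fun h => (hp.1 h).elim hb h0, ih]
      rfl

theorem f_pure_eq_none_of_odd {i : Idx m n} (hi : i.1 + 1 = m) :
    ∀ {N : ℕ} (b : Fin N → Fin (m + n)), (∀ k, b k = i.src → ∃ j < k, b j = i.tgt) →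
      (tensorPow m n N).f i (pure N b) = none
  | 0, _, _ => rfl
  | N + 1, b, h => by
    change (tensor (vec m n) (tensorPow m n N)).f i (b 0, pure N fun k => b k.succ) = _
    simp only [tensor, hi, lt_irrefl, if_false, if_true]
    have h0 : b 0 ≠ i.src := fun h0 => by
      obtain ⟨j, hj, _⟩ := h 0 h0
      exact absurd hj (Fin.not_lt_zero j)
    have hp : 0 < pairing i ((vec m n).wt (b 0)) ↔ b 0 = i.src ∨ b 0 = i.tgt :=
      pairing_eps_pos_iff hi (b 0)
    by_cases hb : b 0 = i.tgt
    · have h1 : (vec m n).f i (b 0) = none := if_neg h0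
      rw [if_pos (hp.2 (Or.inr hb)), h1]
      rfl
    · have ih := f_pure_eq_none_of_odd hi (fun k => b k.succ) fun k hk => by
        obtain ⟨j, hj, hbj⟩ := h k.succ hk
        obtain ⟨j, rfl⟩ := Fin.exists_succ_eq.2 (fun hj0 : j = 0 => hb (hj0 ▸ hbj))
        exact ⟨j, Fin.succ_lt_succ_iff.1 hj, hbj⟩
      rw [if_neg fun h => (hp.1 h).elim h0 hb, ih]
      rfl

theorem e_fakeHighestWord {N : ℕ} (hN : 6 = N) (b : Fin N → Fin (2 + 2))
    (hb : (fun k => b (Fin.cast hN k)) = ![0, 0, 0, 3, 1, 2] ∨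
      (fun k => b (Fin.cast hN k)) = ![0, 0, 3, 0, 1, 2]) (i : Idx 2 2) :
    (tensorPow 2 2 N).e i (pure N b) = none := by
  subst hN
  change b = _ ∨ b = _ at hb
  obtain ⟨i, hi⟩ := i
  have hi' : i < 3 := by omega
  interval_cases i
  · refine e_pure_eq_none_of_pos (i := ⟨0, by decide⟩) (by decide) ?_
    rcases hb with rfl | rfl <;> rfl
  · refine e_pure_eq_none_of_odd (i := ⟨1, by decide⟩) (by decide) _ ?_
    rcases hb with rfl | rfl <;> decide
  · refine e_pure_eq_none_of_neg (i := ⟨2, by decide⟩) (by decide) _ ?_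
    rcases hb with rfl | rfl <;> decide

theorem f_fakeLowestWord {N : ℕ} (hN : 6 = N) (b : Fin N → Fin (2 + 2))
    (hb : (fun k => b (Fin.cast hN k)) = ![3, 2, 0, 3, 1, 3] ∨
      (fun k => b (Fin.cast hN k)) = ![3, 2, 3, 0, 1, 3]) (i : Idx 2 2) :
    (tensorPow 2 2 N).f i (pure N b) = none := by
  subst hN
  change b = _ ∨ b = _ at hb
  obtain ⟨i, hi⟩ := i
  have hi' : i < 3 := by omega
  interval_cases i
  · refine f_pure_eq_none_of_pos (i := ⟨0, by decide⟩) (by decide) _ ?_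
    rcases hb with rfl | rfl <;> decide
  · refine f_pure_eq_none_of_odd (i := ⟨1, by decide⟩) (by decide) _ ?_
    rcases hb with rfl | rfl <;> decide
  · refine f_pure_eq_none_of_neg (i := ⟨2, by decide⟩) (by decide) ?_
    rcases hb with rfl | rfl <;> rfl

end Crystal

theorem six_eq_card_staircase : 6 = staircase.card := by decide

/-- The box of the staircase in row `i` and column `j`. -/
def staircaseBox (i j : ℕ) (h : (i, j) ∈ staircase.cells) :
    {c : ℕ × ℕ // c ∈ staircase.cells} := ⟨(i, j), h⟩

/-- The boxes `(0, 0)` and `(1, 1)` are the only pair not ordered by admissibility, so just two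
readings exist. -/
theorem word_of_admissible {r : Reading staircase} (hr : Admissible r)
    {A : Type} (g : {c : ℕ × ℕ // c ∈ staircase.cells} → A) :
    (fun k => g (r (Fin.cast six_eq_card_staircase k))) =
      ![g (staircaseBox 0 2 (by decide)), g (staircaseBox 0 1 (by decide)),
        g (staircaseBox 0 0 (by decide)), g (staircaseBox 1 1 (by decide)),
        g (staircaseBox 1 0 (by decide)), g (staircaseBox 2 0 (by decide))] ∨
    (fun k => g (r (Fin.cast six_eq_card_staircase k))) =
      ![g (staircaseBox 0 2 (by decide)), g (staircaseBox 0 1 (by decide)),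
        g (staircaseBox 1 1 (by decide)), g (staircaseBox 0 0 (by decide)),
        g (staircaseBox 1 0 (by decide)), g (staircaseBox 2 0 (by decide))] := by
  have hcard := six_eq_card_staircase
  have hlt : ∀ i j i' j' (h : (i, j) ∈ staircase.cells) (h' : (i', j') ∈ staircase.cells),
      i ≤ i' → j' ≤ j → (i < i' ∨ j' < j) →
      (r.symm (staircaseBox i j h)).1 < (r.symm (staircaseBox i' j' h')).1 :=
    fun i j i' j' h h' h1 h2 h3 => Fin.lt_def.1 (hr _ _ (StrictlyHigher.mk h1 h2 h3))
  have h1 := hlt 0 2 0 1 (by decide) (by decide) (by omega) (by omega) (by omega)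
  have h2 := hlt 0 1 0 0 (by decide) (by decide) (by omega) (by omega) (by omega)
  have h3 := hlt 0 1 1 1 (by decide) (by decide) (by omega) (by omega) (by omega)
  have h4 := hlt 0 0 1 0 (by decide) (by decide) (by omega) (by omega) (by omega)
  have h5 := hlt 1 1 1 0 (by decide) (by decide) (by omega) (by omega) (by omega)
  have h6 := hlt 1 0 2 0 (by decide) (by decide) (by omega) (by omega) (by omega)
  have h7 := (r.symm (staircaseBox 2 0 (by decide))).2
  have h8 : (r.symm (staircaseBox 0 0 (by decide))).1 ≠ (r.symm (staircaseBox 1 1 (by decide))).1 := fun h =>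
    absurd (r.symm.injective (Fin.ext h)) (by decide)
  have key : ∀ (k : Fin 6) c, (r.symm c).1 = k.1 → g (r (Fin.cast six_eq_card_staircase k)) = g c :=
    fun k c h => congrArg g (r.symm_apply_eq.1 (Fin.ext h)).symm
  rcases lt_or_gt_of_ne h8 with h9 | h9
  · left
    funext k
    fin_cases k <;> refine key _ _ ?_ <;> simp only <;> omega
  · right
    funext k
    fin_cases k <;> refine key _ _ ?_ <;> simp only <;> omega

/-- The tableau with rows `2̄ 2̄ 2̄`, `1̄ 2` and `1`. -/
def fakeHighest : Tableau 2 2 staircase where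
  entry c := if c.1 = (1, 1) then 3 else if c.1.1 = 0 then 0 else if c.1.1 = 1 then 1 else 2
  row_le := by decide
  row_ne := by decide
  col_le := by decide
  col_ne := by decide

/-- The tableau with rows `2̄ 1 2`, `1̄ 2` and `2`. -/
def fakeLowest : Tableau 2 2 staircase where
  entry c := if c.1 = (0, 0) then 0 else if c.1 = (1, 0) then 1 else if c.1 = (0, 1) then 2 else 3
  row_le := by decide
  row_ne := by decide
  col_le := by decide
  col_ne := by decide

/-- The tableau with rows `1̄ 1 2`, `1 2` and `2`. -/
def lowestTableau : Tableau 2 2 staircase where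
  entry c := if c.1 = (0, 0) then 1 else if c.1 = (1, 0) ∨ c.1 = (0, 1) then 2 else 3
  row_le := by decide
  row_ne := by decide
  col_le := by decide
  col_ne := by decide

theorem isHook_staircase : IsHook 2 2 staircase :=
  not_lt.1 fun h => absurd ((YoungDiagram.mem_cells _).2 (YoungDiagram.mem_iff_lt_rowLen.2 h))
    (by decide)

theorem isFakeHighest_fakeHighest {r : Reading staircase} (hr : Admissible r) :
    (crystalOf 2 2 staircase r).IsFakeHighest fakeHighest := by
  constructor
  · intro i
    have h : (Crystal.tensorPow 2 2 staircase.card).e i (read r fakeHighest) = none :=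
      Crystal.e_fakeHighestWord six_eq_card_staircase _ (word_of_admissible hr fakeHighest.entry) i
    change ((Crystal.tensorPow 2 2 staircase.card).e i (read r fakeHighest)).bind _ = none
    rw [h]
    rfl
  · intro h
    -- The entry sums are `6` here and `4` for `H_Y`, so the difference of weights has height `2 >
    -- 0`.
    have h1 := height_nonpos (h.2 (highestTableau isHook_staircase))
    rw [height_sub] at h1
    have h2 := height_wt r fakeHighest
    have h3 := height_wt r (highestTableau isHook_staircase)
    have h4 : ∑ c, ((fakeHighest.entry c).1 : ℤ) = 6 := by decide
    have h5 : ∑ c, (((highestTableau isHook_staircase).entry c).1 : ℤ) = 4 := by decide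
    omega

theorem isFakeLowest_fakeLowest {r : Reading staircase} (hr : Admissible r) :
    (crystalOf 2 2 staircase r).IsFakeLowest fakeLowest := by
  constructor
  · intro i
    have h : (Crystal.tensorPow 2 2 staircase.card).f i (read r fakeLowest) = none :=
      Crystal.f_fakeLowestWord six_eq_card_staircase _ (word_of_admissible hr fakeLowest.entry) i
    change ((Crystal.tensorPow 2 2 staircase.card).f i (read r fakeLowest)).bind _ = none
    rw [h]
    rfl
  · intro h
    -- `lowestTableau` has entry sum `14` against `12`, so its weight does not lie above that of
    -- `fakeLowest`.
    have h1 := height_nonpos (h.2 lowestTableau)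
    rw [height_sub] at h1
    have h2 := height_wt r fakeLowest
    have h3 := height_wt r lowestTableau
    have h4 : ∑ c, ((fakeLowest.entry c).1 : ℤ) = 12 := by decide
    have h5 : ∑ c, ((lowestTableau.entry c).1 : ℤ) = 14 := by decide
    omega

end SuperCrystal
theorem mainTheorem4 :
    (∀ (m n : ℕ) (Y : YoungDiagram) (hY : SuperCrystal.IsHook m n Y)
        (r : SuperCrystal.Reading Y), SuperCrystal.Admissible r →
      (SuperCrystal.crystalOf m n Y r).graph.Connected ∧
      (SuperCrystal.crystalOf m n Y r).IsGenuineHighest (SuperCrystal.highestTableau hY) ∧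
      ∀ T : SuperCrystal.Tableau m n Y,
        (SuperCrystal.crystalOf m n Y r).graph.Reachable T (SuperCrystal.highestTableau hY)) ∧
    (∀ r : SuperCrystal.Reading SuperCrystal.staircase, SuperCrystal.Admissible r →
      (∃ T, (SuperCrystal.crystalOf 2 2 SuperCrystal.staircase r).IsFakeHighest T) ∧
      (∃ T, (SuperCrystal.crystalOf 2 2 SuperCrystal.staircase r).IsFakeLowest T)) := by
  refine ⟨fun m n Y hY r hr => ⟨?_, SuperCrystal.isGenuineHighest_highestTableau hY r,
    fun T => SuperCrystal.reachable_of_admissible hr T _⟩,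
    fun r hr => ⟨⟨_, SuperCrystal.isFakeHighest_fakeHighest hr⟩,
      ⟨_, SuperCrystal.isFakeLowest_fakeLowest hr⟩⟩⟩
  have : Nonempty (SuperCrystal.crystalOf m n Y r).carrier := ⟨SuperCrystal.highestTableau hY⟩
  exact ⟨fun T T' => SuperCrystal.reachable_of_admissible hr T T'⟩
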